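/- Let $N_c\ge N_f\ge 1$ be integers. Let $x=(x_1,\dots,x_{N_f-1})$ and $y=(y_1,\dots,y_{N_f-1})$ be nonzero complex numbers, and put $u_k=x_k/x_{k-1}$, $w_k=y_k/y_{k-1}$ for $1\le k\le N_f$, with $x_0=x_{N_f}=y_0=y_{N_f}=1$. Let $t,\tilde t\in\mathbb C$ satisfy $|t\,u_k|<1$ and $|\tilde t\,w_k^{-1}|<1$ for all $k$ (for example $0\le t,\tilde t<1$ and all $|x_k|=|y_k|=1$). Write $[a_1,\dots,a_{N_f-1}]_x$ for the character of the irreducible representation of $SU(N_f)$ with Dynkin label $(a_1,\dots,a_{N_f-1})$ at the torus element $\mathrm{diag}(u_1,\dots,u_{N_f})$, similarly $[\dots]_y$ with $w$, and $[a;b]_{x;y}=[a]_x[b]_y$. In particular $[1,0,\dots,0]_x=\sum_k u_k$ and $[0,\dots,0,1]_y=\sum_k w_k^{-1}$ (both are $1$ if $N_f=1$). The plethystic exponential of a function $f$ of several variables is $\mathrm{PE}[f(v)]=\exp\left(\sum_{m\ge1}\frac1m f(v^m)\right)$, where $v^m$ means that every variable is raised to the power $m$. The refined Hilbert series of $U(N_c)$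 SQCD with $N_f$ flavours is $$g(t,\tilde t,x,y)=\frac1{N_c!\,(2\pi i)^{N_c}}\oint_{|z_1|=1}\frac{dz_1}{z_1}\cdots\oint_{|z_{N_c}|=1}\frac{dz_{N_c}}{z_{N_c}}\prod_{a<b}|z_a-z_b|^2\;\mathrm{PE}\Big[t\,[1,0,\dots,0]_x\sum_a z_a^{-1}+\tilde t\,[0,\dots,0,1]_y\sum_a z_a\Big].$$ Let $\phi_+(z)=\mathrm{PE}\big[\tilde t\,[0,\dots,0,1]_y\,z\big]$ and $\phi_-(z)=\mathrm{PE}\big[t\,[1,0,\dots,0]_x\,z^{-1}\big]$, let $U_m$ and $V_m$ be the $m$-th Fourier coefficients on the unit circle of $\phi_- /\phi_+$ and $\phi_+/\phi_-$, and define $K_{N_c}(i,j)=\sum_{k\ge1}U_{i+k}V_{-j-k}$ for $i,j\ge N_c$ and $K_{N_c}(i,j)=0$ for all other $i,j\ge0$. Then all the series involved converge (absolutely), and: 1. the correction kernel vanishes: $K_{N_c}(i,j)=0$ for all $i,j\ge 0$; 2. the refined Hilbert series is $$g(t,\tilde t,x,y)=\mathrm{PE}\big[[1,0,\dots,0;0,\dots,0,1]_{x;y}\,t\tilde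 t\big]=\frac1{1-(t\tilde t)^{N_f}}\sum_{n_1,\dots,n_{N_f-1}=0}^{\infty}[n_1,n_2,\dots,n_{N_f-1};n_{N_f-1},\dots,n_2,n_1]_{x;y}\,(t\tilde t)^{\sum_{j=1}^{N_f-1}j\,n_j};$$ 3. the unrefined Hilbert series, obtained by setting all $x_k=y_k=1$, is $$g(t,\tilde t,1,1)=\frac1{(1-t\tilde t)^{N_f^2}}.$$ -/

import Mathlib

open scoped Nat

noncomputable section

namespace SQCD

/-! ### Plethystic exponential

For a function `f` of several variables (collected in a commutative monoid `A` such as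
`ℂ × ℂ × (Fin r → ℂ)`, where powers are taken componentwise),
`PE f v = exp (∑_{m ≥ 1} f (v ^ m) / m)`. -/

/-- The `m`-th term (`m` is shifted by one) of the series inside the plethystic exponential. -/
def peTerm {A : Type*} [Monoid A] (f : A → ℂ) (v : A) (m : ℕ) : ℂ :=
  f (v ^ (m + 1)) / ((m : ℂ) + 1)

/-- The series inside the plethystic exponential converges. -/
def PEConverges {A : Type*} [Monoid A] (f : A → ℂ) (v : A) : Prop :=
  Summable (peTerm f v)

/-- The plethystic exponential. -/
def PE {A : Type*} [Monoid A] (f : A → ℂ) (v : A) : ℂ :=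
  Complex.exp (∑' m : ℕ, peTerm f v m)

/-! ### Characters of `SU(r + 1)`

The fugacities are `x_1, …, x_r`.  The point of the maximal torus with these fugacities is
`diag (x_1, x_2 / x_1, …, x_r / x_{r-1}, 1 / x_r)`. -/

/-- The eigenvalues `x_k / x_{k-1}`, `1 ≤ k ≤ r + 1`, with the convention `x_0 = x_{r+1} = 1`. -/
def eigenvalue {r : ℕ} (x : Fin r → ℂ) (k : Fin (r + 1)) : ℂ :=
  (Fin.snoc x 1 : Fin (r + 1) → ℂ) k / (Fin.cons 1 x : Fin (r + 1) → ℂ) k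

/-- The fundamental character `[1,0,…,0]_x = x_1 + ∑ x_{k+1} / x_k + 1 / x_r`. -/
def fundChar {r : ℕ} (x : Fin r → ℂ) : ℂ := ∑ k, eigenvalue x k

/-- The antifundamental character `[0,…,0,1]_y = 1 / y_1 + ∑ y_k / y_{k+1} + y_r`. -/
def antifundChar {r : ℕ} (y : Fin r → ℂ) : ℂ := ∑ k, (eigenvalue y k)⁻¹

/-- The partition `λ_i = a_i + a_{i+1} + … + a_r` (so `λ_{r+1} = 0`) of a Dynkin label. -/
def partitionOfLabel {r : ℕ} (a : Fin r → ℕ) (i : Fin (r + 1)) : ℕ :=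
  ∑ j : Fin r, if (i : ℕ) ≤ (j : ℕ) then a j else 0

/-- The alternant `det (u_k ^ (λ_i + r + 1 - i))`, `1 ≤ i, k ≤ r + 1`, as a polynomial in `u`. -/
def alternant {r : ℕ} (lam : Fin (r + 1) → ℕ) : MvPolynomial (Fin (r + 1)) ℂ :=
  Matrix.det (Matrix.of fun k i : Fin (r + 1) =>
    (MvPolynomial.X k : MvPolynomial (Fin (r + 1)) ℂ) ^ (lam i + (Fin.rev i : ℕ)))

/-- The alternant of the zero partition is the Vandermonde determinant, and it divides every
alternant. -/
theorem alternant_zero_dvd {r : ℕ} (lam : Fin (r + 1) → ℕ) :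
    alternant (0 : Fin (r + 1) → ℕ) ∣ alternant lam := by
  classical
  let R := MvPolynomial (Fin (r + 1)) ℂ
  let P : Polynomial R := ∏ k : Fin (r + 1), (Polynomial.X - Polynomial.C (MvPolynomial.X k))
  have hP : P.Monic :=
    Polynomial.monic_prod_of_monic _ _ fun k _ => Polynomial.monic_X_sub_C (MvPolynomial.X k)
  have hdeg : P.natDegree = r + 1 := by
    simp only [P]
    rw [Polynomial.natDegree_prod_of_monic _ _ fun k _ => Polynomial.monic_X_sub_C _]
    simp
  have hroot : ∀ k, P.eval (MvPolynomial.X k) = 0 := by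
    intro k
    rw [Polynomial.eval_prod]
    exact Finset.prod_eq_zero (Finset.mem_univ k) (by simp)
  let F : Fin (r + 1) → Polynomial R := fun i =>
    (Polynomial.X ^ (lam i + (Fin.rev i : ℕ)) : Polynomial R) %ₘ P
  have hF : ∀ i, (F i).natDegree < r + 1 := by
    intro i
    have h := Polynomial.natDegree_modByMonic_lt
      (Polynomial.X ^ (lam i + (Fin.rev i : ℕ)) : Polynomial R) hP
      (by intro h; rw [h] at hdeg; simp at hdeg)
    rwa [hdeg] at h
  refine ⟨Matrix.det (Matrix.of fun m i : Fin (r + 1) => (F i).coeff (Fin.rev m : ℕ)), ?_⟩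
  rw [alternant, alternant, ← Matrix.det_mul]
  congr 1
  ext1 k i
  have h1 : (F i).eval (MvPolynomial.X k)
      = (MvPolynomial.X k : R) ^ (lam i + (Fin.rev i : ℕ)) := by
    have h := congrArg (Polynomial.eval (MvPolynomial.X k : R))
      (Polynomial.modByMonic_add_div
        (Polynomial.X ^ (lam i + (Fin.rev i : ℕ)) : Polynomial R) P)
    simpa [F, hroot k] using h
  rw [Matrix.mul_apply, Matrix.of_apply, ← h1, Polynomial.eval_eq_sum_range' (hF i),
    ← Fin.sum_univ_eq_sum_range
      (fun m => (F i).coeff m * (MvPolynomial.X k : R) ^ m) (r + 1), ← Equiv.sum_comp Fin.revPerm]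
  simp [mul_comm]

/-- The character polynomial of the irreducible representation of `SU(r + 1)` with Dynkin label
`a` in the torus eigenvalues, by the Weyl character formula: the quotient of the alternant of the
highest weight by the Weyl denominator (the Schur polynomial of the partition). -/
def irrepPoly {r : ℕ} (a : Fin r → ℕ) : MvPolynomial (Fin (r + 1)) ℂ :=
  Classical.choose (alternant_zero_dvd (partitionOfLabel a))

theorem alternant_eq_mul_irrepPoly {r : ℕ} (a : Fin r → ℕ) :
    alternant (partitionOfLabel a) = alternant 0 * irrepPoly a :=
  Classical.choose_spec (alternant_zero_dvd (partitionOfLabel a))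

/-- The character `[a_1, …, a_r]_x` of the irreducible representation with Dynkin label `a`. -/
def irrepChar {r : ℕ} (a : Fin r → ℕ) (x : Fin r → ℂ) : ℂ :=
  MvPolynomial.eval (eigenvalue x) (irrepPoly a)

/-- The character `[a_1, …, a_r; b_1, …, b_r]_{x;y}` of `SU(r + 1) × SU(r + 1)`. -/
def biChar {r : ℕ} (a b : Fin r → ℕ) (x y : Fin r → ℂ) : ℂ :=
  irrepChar a x * irrepChar b y

/-! ### The Hilbert series of `U(n)` SQCD with `r + 1` flavours -/

/-- `∏_{a < b} |z_a - z_b|²`. -/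
def vandermondeSq {n : ℕ} (z : Fin n → ℂ) : ℝ :=
  ∏ a : Fin n, ∏ b ∈ Finset.Ioi a, ‖z a - z b‖ ^ 2

/-- The integral over `U(n)` with respect to Haar measure of a class function `F` of the
eigenvalues:
`1 / (n! (2πi)^n) ∮ dz_1 / z_1 ⋯ ∮ dz_n / z_n ∏_{a < b} |z_a - z_b|² F(z)`. -/
def haarU (n : ℕ) (F : (Fin n → ℂ) → ℂ) : ℂ :=
  ((n ! : ℂ) * (2 * Real.pi * Complex.I) ^ n)⁻¹ *
    torusIntegral (fun z => (∏ a, (z a)⁻¹) * (vandermondeSq z : ℂ) * F z) 0 1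

/-- The character `t [1,0,…,0]_x ∑_a z_a⁻¹ + s [0,…,0,1]_y ∑_a z_a` of quarks and antiquarks,
as a function of `(t, s, x, y, z)`. -/
def quarkChar {r n : ℕ} :
    ℂ × ℂ × (Fin r → ℂ) × (Fin r → ℂ) × (Fin n → ℂ) → ℂ :=
  fun (t, s, x, y, z) => t * fundChar x * ∑ a, (z a)⁻¹ + s * antifundChar y * ∑ a, z a

/-- The refined Hilbert series `g_{r+1, U(n)} (t, s, x, y)`. -/
def hilbertSeries {r : ℕ} (n : ℕ) (t s : ℂ) (x y : Fin r → ℂ) : ℂ :=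
  haarU n fun z => PE quarkChar (t, s, x, y, z)

/-- The character `[1,0,…,0;0,…,0,1]_{x;y} t s` of the mesons, as a function of `(t, s, x, y)`. -/
def mesonChar {r : ℕ} : ℂ × ℂ × (Fin r → ℂ) × (Fin r → ℂ) → ℂ :=
  fun (t, s, x, y) => fundChar x * antifundChar y * (t * s)

/-! ### The correction kernel in the Geronimo–Case–Borodin–Okounkov formula -/

/-- The Wiener–Hopf factor `φ₊(z) = PE [s [0,…,0,1]_y z]`. -/
def phiPlus {r : ℕ} (s : ℂ) (y : Fin r → ℂ) (z : ℂ) : ℂ :=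
  PE (fun v : ℂ × (Fin r → ℂ) × ℂ => v.1 * antifundChar v.2.1 * v.2.2) (s, y, z)

/-- The Wiener–Hopf factor `φ₋(z) = PE [t [1,0,…,0]_x z⁻¹]`. -/
def phiMinus {r : ℕ} (t : ℂ) (x : Fin r → ℂ) (z : ℂ) : ℂ :=
  PE (fun v : ℂ × (Fin r → ℂ) × ℂ => v.1 * fundChar v.2.1 * v.2.2⁻¹) (t, x, z)

/-- The Fourier coefficient `1 / (2πi) ∮ dz f(z) z^{-m-1}`. -/
def fourierCoeffCircle (f : ℂ → ℂ) (m : ℤ) : ℂ :=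
  (2 * Real.pi * Complex.I)⁻¹ * circleIntegral (fun z => f z * z ^ (-m - 1)) 0 1

/-- `U_m`, the Fourier coefficients of `φ₋ / φ₊`. -/
def coeffU {r : ℕ} (t s : ℂ) (x y : Fin r → ℂ) (m : ℤ) : ℂ :=
  fourierCoeffCircle (fun z => phiMinus t x z / phiPlus s y z) m

/-- `V_m`, the Fourier coefficients of `φ₊ / φ₋`. -/
def coeffV {r : ℕ} (t s : ℂ) (x y : Fin r → ℂ) (m : ℤ) : ℂ :=
  fourierCoeffCircle (fun z => phiPlus s y z / phiMinus t x z) m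

/-- The summand `U_{i+k} V_{-j-k}` of the kernel, `k ≥ 1` being shifted by one. -/
def kernelTerm {r : ℕ} (t s : ℂ) (x y : Fin r → ℂ) (i j k : ℕ) : ℂ :=
  coeffU t s x y ((i : ℤ) + ((k : ℤ) + 1)) * coeffV t s x y (-(j : ℤ) - ((k : ℤ) + 1))

/-- The kernel `K_n(i, j) = ∑_{k ≥ 1} U_{i+k} V_{-j-k}` if `i, j ≥ n`, and `0` otherwise
(rows and columns are numbered from `0`). -/
def kernelK {r : ℕ} (n : ℕ) (t s : ℂ) (x y : Fin r → ℂ) (i j : ℕ) : ℂ :=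
  if n ≤ i ∧ n ≤ j then ∑' k : ℕ, kernelTerm t s x y i j k else 0

end SQCD

end

namespace SQCD

open PowerSeries Filter Topology

/-! Put `N = r + 1`, `a_k = t u_k`, `b_k = s / w_k`. On the unit torus the integrand is Haar density
times `∏ f(z_a)` with `f(z) = ∏ (1 - a_k / z)⁻¹ ∏ (1 - b_k z)⁻¹`, so by the Heine identity
(`haarU_prod_eq_det`) the Hilbert series is a Toeplitz determinant. Expanding both factors of `f`
turns its entries into `∑_p h_{p-i}(a) h_{p-j}(b)`, a Gram matrix (`gram`).

When the size is `N`, let `E` be the matrix that writes the powers `a_k ^ p` through the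
`h_{p-i}(a)`. Its determinant is the Vandermonde determinant of `a`, and `E * gram` has entries `a_k
^ j ∏_l (1 - a_k b_l)⁻¹`. Cancelling the Vandermonde determinant leaves `∏ (1 - a_k b_l)⁻¹` for
distinct `a_k`, and continuity removes the restriction (`det_gram`). Larger sizes reduce to this by
appending zero variables (`det_gram_of_le`). This product is the plethystic exponential of the meson
character.

For the character expansion, the Cauchy–Binet formula (`hasSum_cauchyBinet`) writes the Gram
determinant of size `N` as a sum over partitions of products of Jacobi–Trudi determinants. A
partition is a Dynkin label together with `c` columns of full length `N`. As `∏ u_k = ∏ w_k = 1`,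
these columns contribute only `(t s) ^ (N c)`, a geometric series. Inverting the eigenvalues `w_k`
reverses the label (`jacobiTrudi_dual`).

The kernel is treated separately: `φ₋ / φ₊` is a series in `z⁻¹` times a polynomial in `z` of degree
at most `N`, so `U_m = 0` for `m > N` (`coeffU_eq_zero`). -/

/-! ### Plethystic exponentials of finite sums -/

/-- The plethystic exponential of a finite sum of monomials. -/
theorem peConverges_and_PE_eq_prod {A ι : Type*} [Monoid A] [Fintype ι] {f : A → ℂ} {v : A}
    {w : ι → ℂ} (hw : ∀ j, ‖w j‖ < 1) (hf : ∀ m : ℕ, f (v ^ (m + 1)) = ∑ j, w j ^ (m + 1)) :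
    PEConverges f v ∧ PE f v = ∏ j, (1 - w j)⁻¹ := by
  have h : ∀ j, HasSum (fun m : ℕ => w j ^ (m + 1) / ((m : ℂ) + 1)) (-Complex.log (1 - w j)) := by
    intro j
    -- The term of index `0` in the Taylor series is `1 / 0 = 0`, so shifting the index loses
    -- nothing.
    have h := (hasSum_nat_add_iff' 1).2 (Complex.hasSum_taylorSeries_neg_log (hw j))
    simpa using h
  have h2 : HasSum (peTerm f v) (∑ j, -Complex.log (1 - w j)) := by
    convert! hasSum_sum (s := Finset.univ) fun j _ => h j using 2 with m
    rw [peTerm, hf, Finset.sum_div]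
  refine ⟨h2.summable, ?_⟩
  rw [PE, h2.tsum_eq, Complex.exp_sum]
  refine Finset.prod_congr rfl fun j _ => ?_
  rw [Complex.exp_neg, Complex.exp_log]
  intro h0
  have := hw j
  rw [← sub_eq_zero.1 h0] at this
  simp at this

theorem eigenvalue_pow {r : ℕ} (x : Fin r → ℂ) (m : ℕ) (k : Fin (r + 1)) :
    eigenvalue (x ^ m) k = eigenvalue x k ^ m := by
  rw [eigenvalue, eigenvalue, div_pow]
  congr 1
  · refine Fin.lastCases ?_ (fun i => ?_) k <;> simp
  · refine Fin.cases ?_ (fun i => ?_) k <;> simp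

theorem prod_eigenvalue {r : ℕ} {x : Fin r → ℂ} (hx : ∀ k, x k ≠ 0) :
    ∏ k, eigenvalue x k = 1 := by
  simp only [eigenvalue, Finset.prod_div_distrib]
  rw [Fin.prod_univ_castSucc, Fin.prod_univ_succ]
  simp [div_self (Finset.prod_ne_zero_iff.2 fun k _ => hx k)]

theorem eigenvalue_ne_zero {r : ℕ} {x : Fin r → ℂ} (hx : ∀ k, x k ≠ 0) (k : Fin (r + 1)) :
    eigenvalue x k ≠ 0 := by
  have h : ∏ k, eigenvalue x k ≠ 0 := by rw [prod_eigenvalue hx]; exact one_ne_zero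
  exact Finset.prod_ne_zero_iff.1 h k (Finset.mem_univ k)

@[simp]
theorem eigenvalue_one {r : ℕ} (k : Fin (r + 1)) : eigenvalue (1 : Fin r → ℂ) k = 1 := by
  have := eigenvalue_pow (1 : Fin r → ℂ) 0 k
  simpa using this

/-! ### Complete homogeneous symmetric polynomials -/

section Complete

variable {R : Type*} [CommRing R] {ι : Type*} [Fintype ι]

/-- The generating series `∏ (1 - u_k X)⁻¹` of the complete homogeneous symmetric polynomials. -/
noncomputable def completeSeries (u : ι → R) : R⟦X⟧ := ∏ k, PowerSeries.mk fun n => u k ^ n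

/-- The `p`-th coefficient of `X ^ j ∏ (1 - u_k X)⁻¹`, which is `h_{p-j} (u)`. -/
noncomputable def complete (u : ι → R) (j p : ℕ) : R := coeff p (X ^ j * completeSeries u)

/-- The generating polynomial `∏ (1 - u_k X)`. -/
noncomputable def elemPoly {κ : Type*} (s : Finset κ) (u : κ → R) : Polynomial R :=
  ∏ l ∈ s, (1 - Polynomial.C (u l) * Polynomial.X)

theorem complete_eq_ite (u : ι → R) (j p : ℕ) :
    complete u j p = if j ≤ p then coeff (p - j) (completeSeries u) else 0 :=
  coeff_X_pow_mul' _ _ _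

theorem complete_of_lt (u : ι → R) {j p : ℕ} (h : p < j) : complete u j p = 0 := by
  rw [complete_eq_ite, if_neg (by lia)]

theorem coeff_zero_completeSeries (u : ι → R) : coeff 0 (completeSeries u) = 1 := by
  simp [completeSeries, coeff_zero_eq_constantCoeff, map_prod]

theorem complete_self (u : ι → R) (j : ℕ) : complete u j j = 1 := by
  rw [complete_eq_ite, if_pos le_rfl, Nat.sub_self, coeff_zero_completeSeries]

theorem one_sub_mul_mk_pow (a : R) :
    ((1 - Polynomial.C a * Polynomial.X : Polynomial R) : R⟦X⟧)
      * PowerSeries.mk (fun n => a ^ n) = 1 := by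
  ext n
  rw [Polynomial.coe_sub, Polynomial.coe_mul, Polynomial.coe_C, Polynomial.coe_X,
    Polynomial.coe_one, sub_mul, one_mul, mul_assoc, map_sub, coeff_C_mul, coeff_mk]
  rcases n with _ | n
  · simp
  · rw [coeff_succ_X_mul, coeff_mk, coeff_one, if_neg (by lia)]
    ring

/-- All geometric factors cancel except the one of the omitted index `k`. -/
theorem elemPoly_mul_completeSeries [DecidableEq ι] (u : ι → R) (k : ι) :
    ((elemPoly (Finset.univ.erase k) u : Polynomial R) : R⟦X⟧) * completeSeries u
      = PowerSeries.mk fun n => u k ^ n := by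
  rw [completeSeries, ← Finset.mul_prod_erase _ _ (Finset.mem_univ k), mul_left_comm, elemPoly,
    ← Polynomial.coeToPowerSeries.ringHom_apply, map_prod, ← Finset.prod_mul_distrib,
    Finset.prod_eq_one, mul_one]
  intro l _
  exact one_sub_mul_mk_pow _

theorem natDegree_elemPoly_le {κ : Type*} (s : Finset κ) (u : κ → R) : (elemPoly s u).natDegree ≤ s.card := by
  refine (Polynomial.natDegree_prod_le _ _).trans ?_
  rw [Finset.card_eq_sum_ones]
  refine Finset.sum_le_sum fun l _ => ?_
  compute_degree

theorem completeSeries_map {S : Type*} [CommRing S] (f : R →+* S) (u : ι → R) :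
    (completeSeries u).map f = completeSeries fun k => f (u k) := by
  rw [completeSeries, map_prod, completeSeries]
  refine Finset.prod_congr rfl fun k _ => ?_
  ext n
  simp

theorem map_complete {S : Type*} [CommRing S] (f : R →+* S) (u : ι → R) (j p : ℕ) :
    f (complete u j p) = complete (fun k => f (u k)) j p := by
  rw [complete_eq_ite, complete_eq_ite, ← completeSeries_map, apply_ite f, coeff_map, map_zero]

theorem coeff_completeSeries [DecidableEq ι] (u : ι → R) (n : ℕ) :
    coeff n (completeSeries u)
      = ∑ l ∈ Finset.finsuppAntidiag Finset.univ n, ∏ k, u k ^ (l k) := by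
  simp [completeSeries, coeff_prod]

theorem coeff_completeSeries_mul (a : R) (u : ι → R) (n : ℕ) :
    coeff n (completeSeries fun k => a * u k) = a ^ n * coeff n (completeSeries u) := by
  classical
  rw [coeff_completeSeries, coeff_completeSeries, Finset.mul_sum]
  refine Finset.sum_congr rfl fun l hl => ?_
  rw [Finset.mem_finsuppAntidiag] at hl
  simp_rw [mul_pow]
  rw [Finset.prod_mul_distrib, Finset.prod_pow_eq_pow_sum, hl.1]

/-- Powers of one variable in terms of the complete homogeneous polynomials of all. -/
theorem sum_elemPoly_coeff_mul_complete {N : ℕ} (u : Fin N → R) (k : Fin N) (p : ℕ) :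
    ∑ i : Fin N, (elemPoly (Finset.univ.erase k) u).coeff i * complete u i p = u k ^ p := by
  have h := congrArg (coeff p) (elemPoly_mul_completeSeries u k)
  have hN : 0 < N := k.pos
  have hd : (elemPoly (Finset.univ.erase k) u).natDegree < N := by
    refine (natDegree_elemPoly_le _ _).trans_lt ?_
    rw [Finset.card_erase_of_mem (Finset.mem_univ k), Finset.card_univ, Fintype.card_fin]
    lia
  rw [coeff_mk] at h
  rw [← h]
  conv_rhs => rw [Polynomial.as_sum_range' _ _ hd]
  rw [← Polynomial.coeToPowerSeries.ringHom_apply, map_sum, Finset.sum_mul, map_sum,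
    ← Fin.sum_univ_eq_sum_range (fun i => coeff p (Polynomial.coeToPowerSeries.ringHom
      (Polynomial.monomial i ((elemPoly (Finset.univ.erase k) u).coeff i)) * completeSeries u))]
  refine Finset.sum_congr rfl fun i _ => ?_
  rw [Polynomial.coeToPowerSeries.ringHom_apply, Polynomial.coe_monomial,
    complete, ← PowerSeries.coeff_C_mul, ← mul_assoc, ← PowerSeries.monomial_eq_C_mul_X_pow]

end Complete

/-! ### Absolutely convergent power series -/

theorem summable_norm_coeff_mul {p q : ℂ⟦X⟧} (hp : Summable fun n => ‖coeff n p‖)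
    (hq : Summable fun n => ‖coeff n q‖) : Summable fun n => ‖coeff n (p * q)‖ := by
  convert! summable_norm_sum_mul_antidiagonal_of_summable_norm hp hq using 3 with n
  exact coeff_mul _ _ _

theorem summable_norm_coeff_mul_pow {p : ℂ⟦X⟧} (hp : Summable fun n => ‖coeff n p‖) {z : ℂ}
    (hz : ‖z‖ ≤ 1) : Summable fun n => ‖coeff n p * z ^ n‖ := by
  refine hp.of_nonneg_of_le (fun _ => norm_nonneg _) fun n => ?_
  rw [norm_mul, norm_pow]
  exact mul_le_of_le_one_right (norm_nonneg _) (pow_le_one₀ (norm_nonneg _) hz)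

theorem tsum_coeff_mul_mul_pow {p q : ℂ⟦X⟧} (hp : Summable fun n => ‖coeff n p‖)
    (hq : Summable fun n => ‖coeff n q‖) {z : ℂ} (hz : ‖z‖ ≤ 1) :
    ∑' n, coeff n (p * q) * z ^ n = (∑' n, coeff n p * z ^ n) * ∑' n, coeff n q * z ^ n := by
  rw [tsum_mul_tsum_eq_tsum_sum_antidiagonal_of_summable_norm
    (summable_norm_coeff_mul_pow hp hz) (summable_norm_coeff_mul_pow hq hz)]
  refine tsum_congr fun n => ?_
  rw [coeff_mul, Finset.sum_mul]
  refine Finset.sum_congr rfl fun x hx => ?_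
  rw [← Finset.HasAntidiagonal.mem_antidiagonal.1 hx, pow_add]
  ring

theorem completeSeries_abs {ι : Type*} [Fintype ι] {u : ι → ℂ} (hu : ∀ k, ‖u k‖ < 1) :
    (Summable fun n => ‖coeff n (completeSeries u)‖) ∧ ∀ z : ℂ, ‖z‖ ≤ 1 →
      ∑' n, coeff n (completeSeries u) * z ^ n = ∏ k, (1 - u k * z)⁻¹ := by
  classical
  rw [completeSeries]
  induction (Finset.univ : Finset ι) using Finset.induction_on with
  | empty =>
    constructor
    · refine summable_of_ne_finset_zero (s := {0}) fun n hn => ?_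
      rw [Finset.prod_empty, coeff_one, if_neg (by simpa using hn), norm_zero]
    · intro z _
      rw [tsum_eq_single 0]
      · simp
      · intro n hn
        rw [Finset.prod_empty, coeff_one, if_neg hn, zero_mul]
  | insert k s hk ih =>
    have h1 : Summable fun n => ‖coeff n (PowerSeries.mk fun n => u k ^ n)‖ := by
      simp_rw [coeff_mk, norm_pow]
      exact summable_geometric_of_lt_one (norm_nonneg _) (hu k)
    rw [Finset.prod_insert hk]
    refine ⟨summable_norm_coeff_mul h1 ih.1, fun z hz => ?_⟩
    rw [tsum_coeff_mul_mul_pow h1 ih.1 hz, ih.2 z hz, Finset.prod_insert hk]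
    congr 1
    simp_rw [coeff_mk, ← mul_pow]
    refine tsum_geometric_of_norm_lt_one ?_
    rw [norm_mul]
    exact (mul_le_of_le_one_right (norm_nonneg _) hz).trans_lt (hu k)

theorem summable_norm_coeff_X_pow (j : ℕ) : Summable fun n => ‖coeff n (X ^ j : ℂ⟦X⟧)‖ := by
  refine summable_of_ne_finset_zero (s := {j}) fun n hn => ?_
  rw [coeff_X_pow, if_neg (by simpa using hn), norm_zero]

theorem summable_norm_complete {ι : Type*} [Fintype ι] {u : ι → ℂ} (hu : ∀ k, ‖u k‖ < 1)
    (j : ℕ) : Summable fun p => ‖complete u j p‖ :=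
  summable_norm_coeff_mul (summable_norm_coeff_X_pow j) (completeSeries_abs hu).1

theorem tsum_complete_mul_pow {ι : Type*} [Fintype ι] {u : ι → ℂ} (hu : ∀ k, ‖u k‖ < 1)
    (j : ℕ) {z : ℂ} (hz : ‖z‖ ≤ 1) :
    ∑' p, complete u j p * z ^ p = z ^ j * ∏ k, (1 - u k * z)⁻¹ := by
  rw [← (completeSeries_abs hu).2 z hz]
  refine (tsum_coeff_mul_mul_pow (summable_norm_coeff_X_pow j) (completeSeries_abs hu).1 hz).trans ?_
  congr 1
  rw [tsum_eq_single j]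
  · simp
  · intro n hn
    rw [coeff_X_pow, if_neg hn, zero_mul]

theorem continuous_complete {ι : Type*} [Fintype ι] (j p : ℕ) :
    Continuous fun u : ι → ℂ => complete u j p := by
  classical
  simp_rw [complete_eq_ite]
  split_ifs
  · simp_rw [coeff_completeSeries]
    fun_prop
  · exact continuous_const

/-- The `h_n` have nonnegative coefficients. This gives the bound, uniform in `u`, needed for
dominated convergence. -/
theorem norm_complete_le {ι : Type*} [Fintype ι] {u : ι → ℂ} {ρ : ℝ} (hu : ∀ k, ‖u k‖ ≤ ρ)
    (j p : ℕ) : ‖complete u j p‖ ≤ ‖complete (fun _ : ι => (ρ : ℂ)) j p‖ := by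
  classical
  have h : ‖complete (fun _ : ι => (ρ : ℂ)) j p‖ = |complete (fun _ : ι => ρ) j p| := by
    rw [← Real.norm_eq_abs, ← Complex.norm_real]
    exact congrArg _ (map_complete Complex.ofRealHom _ j p).symm
  rw [h]
  refine le_trans ?_ (le_abs_self _)
  rw [complete_eq_ite, complete_eq_ite]
  split_ifs
  · rw [coeff_completeSeries, coeff_completeSeries]
    refine (norm_sum_le _ _).trans (Finset.sum_le_sum fun l _ => ?_)
    rw [norm_prod]
    refine Finset.prod_le_prod (fun _ _ => norm_nonneg _) fun k _ => ?_
    rw [norm_pow]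
    exact pow_le_pow_left₀ (norm_nonneg _) (hu k) _
  · simp

end SQCD

namespace SQCD

open PowerSeries Filter Topology

/-! ### The Gram matrix of complete homogeneous polynomials -/

/-- The matrix `∑_p h_{p-i} (u) h_{p-j} (v)`, `0 ≤ i, j < N`, which is the Toeplitz matrix of the
symbol `∏ (1 - u_k / z)⁻¹ ∏ (1 - v_k z)⁻¹`. -/
noncomputable def gram {ι : Type*} [Fintype ι] (N : ℕ) (u v : ι → ℂ) : Matrix (Fin N) (Fin N) ℂ :=
  Matrix.of fun i j => ∑' p, complete u i p * complete v j p

theorem summable_norm_mul_of_summable_norm {a b : ℕ → ℂ} (ha : Summable fun n => ‖a n‖)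
    (hb : Summable fun n => ‖b n‖) : Summable fun n => ‖a n * b n‖ := by
  simp_rw [norm_mul]
  refine (hb.mul_left (∑' n, ‖a n‖)).of_nonneg_of_le (fun _ => by positivity) fun n => ?_
  exact mul_le_mul_of_nonneg_right (ha.le_tsum n fun _ _ => norm_nonneg _) (norm_nonneg _)

/-- Entries below the diagonal are `h` of negative degree, and the diagonal is `h_0 = 1`. -/
theorem det_complete_lower_eq_one {R : Type*} [CommRing R] {ι : Type*} [Fintype ι] (N : ℕ)
    (u : ι → R) : (Matrix.of fun i j : Fin N => complete u i j).det = 1 := by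
  rw [Matrix.det_of_isUpperTriangular]
  · simp [complete_self]
  · intro i j hij
    exact complete_of_lt u hij

/-- The determinant of the matrix expressing powers through complete homogeneous polynomials. -/
theorem det_elemPoly_coeff {R : Type*} [CommRing R] {N : ℕ} (u : Fin N → R) :
    (Matrix.of fun k i : Fin N => (elemPoly (Finset.univ.erase k) u).coeff i).det
      = (Matrix.vandermonde u).det := by
  rw [← mul_one (Matrix.det _), ← det_complete_lower_eq_one N u, ← Matrix.det_mul]
  congr 1
  ext k j
  rw [Matrix.mul_apply]
  exact sum_elemPoly_coeff_mul_complete u k j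

theorem det_gram_of_injective {N : ℕ} {u v : Fin N → ℂ} (hu : ∀ k, ‖u k‖ < 1)
    (hv : ∀ k, ‖v k‖ < 1) (hinj : Function.Injective u) :
    (gram N u v).det = ∏ k, ∏ l, (1 - u k * v l)⁻¹ := by
  have hV : (Matrix.vandermonde u).det ≠ 0 := Matrix.det_vandermonde_ne_zero_iff.2 hinj
  refine mul_left_cancel₀ hV ?_
  -- Left multiplication by the coefficient matrix replaces `h_{p-i}(u)` by `u_k ^ p`, so the sum
  -- over `p` becomes the generating series of `h_{p-j}(v)` at `z = u_k`.
  conv_lhs => rw [← det_elemPoly_coeff, ← Matrix.det_mul]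
  rw [mul_comm, ← Matrix.det_mul_column]
  congr 1
  ext k j
  rw [Matrix.mul_apply]
  simp only [Matrix.of_apply, gram, Matrix.vandermonde_apply]
  simp_rw [← tsum_mul_left]
  rw [← Summable.tsum_finsetSum]
  · simp_rw [← mul_assoc, ← Finset.sum_mul, sum_elemPoly_coeff_mul_complete]
    have h := tsum_complete_mul_pow hv j (hu k).le
    simp_rw [mul_comm (u k ^ _)]
    rw [h, mul_comm]
    congr 1
    exact Finset.prod_congr rfl fun l _ => by rw [mul_comm]
  · intro i _
    exact ((summable_norm_mul_of_summable_norm (summable_norm_complete hu i)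
      (summable_norm_complete hv j)).of_norm).mul_left _

theorem exists_lt_one_forall_norm_lt {N : ℕ} {u : Fin N → ℂ} (hu : ∀ k, ‖u k‖ < 1) :
    ∃ ρ : ℝ, 0 ≤ ρ ∧ ρ < 1 ∧ ∀ k, ‖u k‖ < ρ := by
  rcases isEmpty_or_nonempty (Fin N) with h | h
  · exact ⟨0, le_rfl, one_pos, fun k => h.elim k⟩
  · obtain ⟨k, -, hk⟩ := Finset.exists_max_image Finset.univ (fun k => ‖u k‖) Finset.univ_nonempty
    obtain ⟨ρ, h1, h2⟩ := exists_between (hu k)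
    exact ⟨ρ, (norm_nonneg _).trans h1.le, h2, fun l => (hk l (Finset.mem_univ l)).trans_lt h1⟩

theorem continuousAt_gram {N : ℕ} {u v : Fin N → ℂ} (hu : ∀ k, ‖u k‖ < 1)
    (hv : ∀ k, ‖v k‖ < 1) : ContinuousAt (fun w : Fin N → ℂ => gram N w v) u := by
  obtain ⟨ρ, h0, h1, hρ⟩ := exists_lt_one_forall_norm_lt hu
  refine continuousAt_pi.2 fun i => continuousAt_pi.2 fun j => ?_
  have hs : Summable fun p => ‖complete (fun _ : Fin N => (ρ : ℂ)) i p * complete v j p‖ :=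
    summable_norm_mul_of_summable_norm
      (summable_norm_complete (fun _ => by rwa [Complex.norm_real, Real.norm_of_nonneg h0]) i)
      (summable_norm_complete hv j)
  refine tendsto_tsum_of_dominated_convergence hs (fun p => ?_) ?_
  · exact ((continuous_complete (i : ℕ) p).mul continuous_const).continuousAt
  · have : ∀ᶠ w in 𝓝 u, ∀ k, ‖w k‖ < ρ := by
      refine eventually_all.2 fun k => ?_
      exact ((continuous_apply k).norm.continuousAt).eventually_lt continuousAt_const (hρ k)
    filter_upwards [this] with w hw p
    rw [norm_mul, norm_mul]
    exact mul_le_mul_of_nonneg_right (norm_complete_le (fun k => (hw k).le) _ _) (norm_nonneg _)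

/-! ### Extension from tuples of distinct numbers by continuity -/

theorem frequently_injective {N : ℕ} (u : Fin N → ℂ) :
    ∃ᶠ w in 𝓝 u, Function.Injective w := by
  let c : ℂ → Fin N → ℂ := fun ε k => u k + ε * (k : ℂ)
  have hc : Tendsto c (𝓝[≠] 0) (𝓝 u) := by
    have : Continuous c := by fun_prop
    have h := this.tendsto 0
    have h0 : c 0 = u := by ext k; simp [c]
    rw [h0] at h
    exact h.mono_left nhdsWithin_le_nhds
  refine hc.frequently (Eventually.frequently ?_)
  have h : ∀ᶠ ε in 𝓝[≠] (0 : ℂ), ∀ k l : Fin N, k ≠ l → c ε k ≠ c ε l := by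
    refine eventually_all.2 fun k => eventually_all.2 fun l => ?_
    by_cases hkl : k = l
    · simp [hkl]
    have hd : ((k : ℕ) : ℂ) - (l : ℕ) ≠ 0 := by
      rw [sub_ne_zero, Ne, Nat.cast_inj]
      exact fun h => hkl (Fin.ext h)
    -- The only `ε` at which the perturbed entries `k` and `l` collide; it may itself be `0`, which
    -- the punctured neighbourhood excludes.
    have hfin : ∀ᶠ ε in 𝓝[≠] (0 : ℂ), ε ≠ (u l - u k) / ((k : ℂ) - l) := by
      by_cases h0 : (u l - u k) / ((k : ℂ) - l) = 0
      · rw [h0]; exact eventually_mem_nhdsWithin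
      · exact (eventually_ne_nhds (Ne.symm h0)).filter_mono nhdsWithin_le_nhds
    filter_upwards [hfin] with ε hε _ h
    apply hε
    rw [eq_div_iff hd]
    simp only [c] at h
    linear_combination h
  filter_upwards [h] with ε hε k l hkl
  by_contra hne
  exact hε k l hne hkl

/-- Tuples with distinct entries accumulate at every point, so an identity proved by cancelling a
Vandermonde determinant extends to coinciding entries. -/
theorem eq_of_continuousAt_of_injective {N : ℕ} {F G : (Fin N → ℂ) → ℂ} {u : Fin N → ℂ}
    (hF : ContinuousAt F u) (hG : ContinuousAt G u)
    (h : ∀ᶠ w in 𝓝 u, Function.Injective w → F w = G w) : F u = G u := by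
  by_contra hne
  have h1 : ∀ᶠ w in 𝓝 u, F w ≠ G w :=
    (hF.prodMk hG).eventually (isOpen_ne_fun continuous_fst continuous_snd |>.mem_nhds hne)
  obtain ⟨w, hw, h2, h3⟩ := ((frequently_injective u).and_eventually (h.and h1)).exists
  exact h3 (h2 hw)

theorem one_sub_ne_zero_of_norm_lt_one {a : ℂ} (ha : ‖a‖ < 1) : 1 - a ≠ 0 := by
  intro h
  rw [← sub_eq_zero.1 h] at ha
  simp at ha

theorem norm_mul_lt_one {a b : ℂ} (ha : ‖a‖ < 1) (hb : ‖b‖ < 1) : ‖a * b‖ < 1 := by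
  rw [norm_mul]
  exact mul_lt_one_of_nonneg_of_lt_one_left (norm_nonneg _) ha hb.le

theorem det_gram {N : ℕ} {u v : Fin N → ℂ} (hu : ∀ k, ‖u k‖ < 1) (hv : ∀ k, ‖v k‖ < 1) :
    (gram N u v).det = ∏ k, ∏ l, (1 - u k * v l)⁻¹ := by
  refine eq_of_continuousAt_of_injective (F := fun w => (gram N w v).det)
    (G := fun w => ∏ k, ∏ l, (1 - w k * v l)⁻¹) ?_ ?_ ?_
  · exact (Continuous.matrix_det continuous_id).continuousAt.comp (continuousAt_gram hu hv)
  · refine tendsto_finsetProd _ fun k _ => tendsto_finsetProd _ fun l _ => ?_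
    refine ContinuousAt.inv₀ ?_ (one_sub_ne_zero_of_norm_lt_one (norm_mul_lt_one (hu k) (hv l)))
    exact (continuous_const.sub ((continuous_apply k).mul continuous_const)).continuousAt
  · have : ∀ᶠ w in 𝓝 u, ∀ k, ‖w k‖ < 1 := by
      refine eventually_all.2 fun k => ?_
      exact ((continuous_apply k).norm.continuousAt).eventually_lt continuousAt_const (hu k)
    filter_upwards [this] with w hw hi
    exact det_gram_of_injective hw hv hi

/-- Extension by zero does not change the symmetric functions. -/
theorem completeSeries_append_zero {R : Type*} [CommRing R] {M N : ℕ} (u : Fin M → R) :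
    completeSeries (Fin.append u (0 : Fin N → R)) = completeSeries u := by
  have h : (PowerSeries.mk fun n => (0 : R) ^ n) = 1 := by
    ext n
    rw [coeff_mk, coeff_one, zero_pow_eq]
  simp [completeSeries, Fin.prod_univ_add, h]

/-- The Gram determinant stabilizes once its size reaches the number of variables. -/
theorem det_gram_of_le {M N : ℕ} (hMN : M ≤ N) {u v : Fin M → ℂ} (hu : ∀ k, ‖u k‖ < 1)
    (hv : ∀ k, ‖v k‖ < 1) : (gram N u v).det = ∏ k, ∏ l, (1 - u k * v l)⁻¹ := by
  obtain ⟨K, rfl⟩ := Nat.exists_eq_add_of_le hMN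
  have hpad : ∀ w : Fin M → ℂ, (∀ k, ‖w k‖ < 1) →
      ∀ k, ‖(Fin.append w (0 : Fin K → ℂ)) k‖ < 1 := by
    intro w hw k
    refine Fin.addCases (fun i => ?_) (fun i => ?_) k <;> simp [hw]
  have h : gram (M + K) u v
      = gram (M + K) (Fin.append u (0 : Fin K → ℂ)) (Fin.append v (0 : Fin K → ℂ)) := by
    simp only [gram, complete, completeSeries_append_zero]
  rw [h, det_gram (hpad u hu) (hpad v hv)]
  simp [Fin.prod_univ_add]

end SQCD

namespace SQCD

open MeasureTheory

/-! ### Averages over the circle and the torus -/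

/-- The mean of a function over the unit circle. -/
noncomputable def circleMean (f : ℂ → ℂ) : ℂ :=
  (2 * Real.pi : ℂ)⁻¹ * ∫ θ in Set.Icc 0 (2 * Real.pi), f (Complex.exp (θ * Complex.I))

theorem circleMean_congr {f g : ℂ → ℂ} (h : ∀ z, ‖z‖ = 1 → f z = g z) :
    circleMean f = circleMean g := by
  simp only [circleMean, h _ (Complex.norm_exp_ofReal_mul_I _)]

theorem fourierCoeffCircle_eq_circleMean (f : ℂ → ℂ) (m : ℤ) :
    fourierCoeffCircle f m = circleMean fun z => f z * z ^ (-m) := by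
  rw [fourierCoeffCircle, circleMean, circleIntegral_def_Icc, mul_inv, mul_assoc,
    ← integral_const_mul]
  congr 2
  ext θ
  have h := Complex.exp_ne_zero (θ * Complex.I)
  simp only [deriv_circleMap, circleMap, zero_add, Complex.ofReal_one, one_mul, smul_eq_mul]
  rw [zpow_sub₀ h, zpow_one]
  field_simp

theorem circleMean_zpow (n : ℤ) : circleMean (fun z => z ^ n) = if n = 0 then 1 else 0 := by
  have h := fourierCoeffCircle_eq_circleMean (fun _ => 1) (-n)
  simp only [one_mul, neg_neg] at h
  rw [← h, fourierCoeffCircle]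
  simp only [one_mul, neg_neg]
  split_ifs with hn
  · subst hn
    have h1 := circleIntegral.integral_sub_center_inv (0 : ℂ) one_ne_zero
    simp only [sub_zero] at h1
    simp only [zero_sub, zpow_neg, zpow_one, h1]
    exact inv_mul_cancel₀ Complex.two_pi_I_ne_zero
  · have h1 := circleIntegral.integral_sub_zpow_of_ne (n := n - 1) (by lia) (0 : ℂ) 0 1
    simp only [sub_zero] at h1
    rw [h1, mul_zero]

theorem circleMean_mul_pow (p q : ℕ) :
    circleMean (fun z => z⁻¹ ^ p * z ^ q) = if p = q then 1 else 0 := by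
  have h : circleMean (fun z => z⁻¹ ^ p * z ^ q) = circleMean fun z => z ^ ((q : ℤ) - p) := by
    refine circleMean_congr fun z hz => ?_
    have : z ≠ 0 := by rintro rfl; simp at hz
    rw [zpow_sub₀ this, inv_pow, zpow_natCast, zpow_natCast]
    field_simp
  rw [h, circleMean_zpow]
  congr 1
  rw [sub_eq_zero, Nat.cast_inj]
  exact propext eq_comm

/-- The mean of the product of a series in `z⁻¹` and a series in `z`. -/
theorem circleMean_tsum_mul_tsum {a b : ℕ → ℂ} (ha : Summable fun n => ‖a n‖)
    (hb : Summable fun n => ‖b n‖) :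
    circleMean (fun z => (∑' p, a p * z⁻¹ ^ p) * ∑' q, b q * z ^ q) = ∑' p, a p * b p := by
  let e : ℝ → ℂ := fun θ => Complex.exp (θ * Complex.I)
  have he : ∀ θ, ‖e θ‖ = 1 := Complex.norm_exp_ofReal_mul_I
  let F : ℕ × ℕ → ℝ → ℂ := fun x θ => (a x.1 * (e θ)⁻¹ ^ x.1) * (b x.2 * e θ ^ x.2)
  have hFn : ∀ x θ, ‖F x θ‖ = ‖a x.1‖ * ‖b x.2‖ := by
    intro x θ
    simp only [F, norm_mul, norm_pow, norm_inv, he, inv_one, one_pow, mul_one]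
  have hab : Summable fun x : ℕ × ℕ => ‖a x.1‖ * ‖b x.2‖ :=
    ha.mul_of_nonneg hb (fun _ => norm_nonneg _) fun _ => norm_nonneg _
  have hcont : ∀ x, Continuous (F x) := by
    intro x
    have h1 : Continuous e := by fun_prop
    have h2 : Continuous fun θ => (e θ)⁻¹ := h1.inv₀ fun θ => Complex.exp_ne_zero _
    fun_prop
  have hint : ∀ x, Integrable (F x) (volume.restrict (Set.Icc 0 (2 * Real.pi))) := fun x =>
    (hcont x).integrableOn_Icc
  have key := hasSum_integral_of_summable_integral_norm hint (by
    simp only [hFn, integral_const]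
    exact hab.const_smul _)
  have hmean : ∀ x, (2 * Real.pi : ℂ)⁻¹ * ∫ θ in Set.Icc 0 (2 * Real.pi), F x θ
      = if x.1 = x.2 then a x.1 * b x.2 else 0 := by
    intro x
    have h := circleMean_mul_pow x.1 x.2
    rw [circleMean] at h
    have h2 : ∀ θ, F x θ = a x.1 * b x.2 * ((e θ)⁻¹ ^ x.1 * e θ ^ x.2) := by
      intro θ; simp only [F]; ring
    simp_rw [h2]
    rw [integral_const_mul, mul_left_comm, h, mul_ite, mul_one, mul_zero]
  have key2 := (key.mul_left (2 * Real.pi : ℂ)⁻¹)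
  simp_rw [hmean] at key2
  have hprod : ∀ θ, (∑' p, a p * (e θ)⁻¹ ^ p) * ∑' q, b q * e θ ^ q = ∑' x, F x θ := by
    intro θ
    refine tsum_mul_tsum_of_summable_norm ?_ ?_ <;>
      simpa only [norm_mul, norm_pow, norm_inv, he, inv_one, one_pow, mul_one]
  rw [circleMean]
  change (2 * Real.pi : ℂ)⁻¹ * ∫ θ in Set.Icc 0 (2 * Real.pi),
    (∑' p, a p * (e θ)⁻¹ ^ p) * ∑' q, b q * e θ ^ q = _
  simp_rw [hprod]
  rw [← key2.tsum_eq]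
  -- Orthogonality leaves only the diagonal of the double sum.
  have hinj : Function.Injective fun p : ℕ => (p, p) := fun p q h => (Prod.ext_iff.1 h).1
  rw [← hinj.tsum_eq]
  · simp
  · intro x hx
    rw [Function.mem_support] at hx
    refine ⟨x.1, ?_⟩
    by_contra h
    exact hx (if_neg fun h' => h (Prod.ext rfl h'))

/-- On the unit circle inversion is conjugation, so the second determinant is the conjugate of the
first. -/
theorem vandermondeSq_eq {n : ℕ} {z : Fin n → ℂ} (hz : ∀ a, ‖z a‖ = 1) :
    (vandermondeSq z : ℂ)
      = (Matrix.vandermonde z).det * (Matrix.vandermonde fun a => (z a)⁻¹).det := by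
  rw [Matrix.det_vandermonde, Matrix.det_vandermonde, vandermondeSq, ← Finset.prod_mul_distrib,
    Complex.ofReal_prod]
  refine Finset.prod_congr rfl fun a _ => ?_
  rw [← Finset.prod_mul_distrib, Complex.ofReal_prod]
  refine Finset.prod_congr rfl fun b _ => ?_
  rw [Complex.inv_eq_conj (hz a), Complex.inv_eq_conj (hz b), ← map_sub, Complex.mul_conj,
    norm_sub_rev, Complex.normSq_eq_norm_sq]

/-- For fixed `τ` the sum over `σ` is the determinant with columns permuted by `τ`; the two signs of
`τ` cancel, and each of the `n!` choices gives the same value. -/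
theorem sum_sign_mul_sign_prod {n : ℕ} (M : Matrix (Fin n) (Fin n) ℂ) :
    ∑ σ : Equiv.Perm (Fin n), ∑ τ : Equiv.Perm (Fin n),
      ((Equiv.Perm.sign σ : ℤ) : ℂ) * ((Equiv.Perm.sign τ : ℤ) : ℂ) * ∏ a, M (σ a) (τ a)
      = (n ! : ℂ) * M.det := by
  rw [Finset.sum_comm]
  have h : ∀ τ : Equiv.Perm (Fin n), ∑ σ : Equiv.Perm (Fin n),
      ((Equiv.Perm.sign σ : ℤ) : ℂ) * ((Equiv.Perm.sign τ : ℤ) : ℂ) * ∏ a, M (σ a) (τ a)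
      = M.det := by
    intro τ
    have h1 := Matrix.det_permute' τ M
    rw [Matrix.det_apply'] at h1
    have h2 : ((Equiv.Perm.sign τ : ℤ) : ℂ) * ((Equiv.Perm.sign τ : ℤ) : ℂ) = 1 := by
      rw [← Int.cast_mul, ← Units.val_mul, Int.units_mul_self]; simp
    rw [← one_mul M.det, ← h2, mul_assoc, ← h1, Finset.mul_sum]
    refine Finset.sum_congr rfl fun σ _ => ?_
    simp only [Matrix.submatrix_apply, id]
    ring
  simp_rw [h]
  simp [Fintype.card_perm]

/-- The Heine identity: the average of a multiplicative class function over `U(n)` is a Toeplitz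
determinant. -/
theorem haarU_prod_eq_det (n : ℕ) {f : ℂ → ℂ}
    (hf : Continuous fun θ : ℝ => f (Complex.exp (θ * Complex.I))) :
    haarU n (fun z => ∏ a, f (z a))
      = (Matrix.of fun i j : Fin n =>
          circleMean fun z => f z * (z ^ (i : ℕ) * z⁻¹ ^ (j : ℕ))).det := by
  let e : ℝ → ℂ := fun θ => Complex.exp (θ * Complex.I)
  have he : ∀ θ, ‖e θ‖ = 1 := Complex.norm_exp_ofReal_mul_I
  have hec : Continuous e := by fun_prop
  have hei : Continuous fun θ => (e θ)⁻¹ := hec.inv₀ fun θ => Complex.exp_ne_zero _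
  let G : ℕ → ℕ → ℝ → ℂ := fun i j θ => f (e θ) * (e θ ^ i * (e θ)⁻¹ ^ j)
  have hG : ∀ i j, Continuous (G i j) := fun i j =>
    hf.mul ((hec.pow i).mul (hei.pow j))
  let μ : Measure ℝ := volume.restrict (Set.Icc 0 (2 * Real.pi))
  have hμ : (volume.restrict (Set.Icc (0 : Fin n → ℝ) fun _ => 2 * Real.pi))
      = Measure.pi fun _ => μ := by
    rw [volume_pi, ← Set.pi_univ_Icc, Measure.restrict_pi_pi]
    rfl
  have hint : ∀ i j, Integrable (G i j) μ := fun i j => (hG i j).integrableOn_Icc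
  have hpt : ∀ θ : Fin n → ℝ,
      (∏ i, ((1 : Fin n → ℝ) i : ℂ) * Complex.exp (θ i * Complex.I) * Complex.I) •
        ((∏ a, (torusMap 0 1 θ a)⁻¹) * (vandermondeSq (torusMap 0 1 θ) : ℂ)
          * ∏ a, f (torusMap 0 1 θ a))
      = Complex.I ^ n * ∑ σ : Equiv.Perm (Fin n), ∑ τ : Equiv.Perm (Fin n),
        ((Equiv.Perm.sign σ : ℤ) : ℂ) * ((Equiv.Perm.sign τ : ℤ) : ℂ)
          * ∏ a, G (σ a) (τ a) (θ a) := by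
    intro θ
    have ht : torusMap 0 1 θ = fun a => e (θ a) := by
      ext a; simp [torusMap, e]
    -- Transposing makes the Leibniz products run over the points `a`, so each summand is a product
    -- of functions of a single `θ a` and Fubini applies.
    rw [ht, vandermondeSq_eq fun a => he (θ a), ← Matrix.det_transpose,
      ← Matrix.det_transpose (Matrix.vandermonde fun a => (e (θ a))⁻¹), Matrix.det_apply',
      Matrix.det_apply', Finset.sum_mul_sum]
    simp only [Pi.one_apply, Complex.ofReal_one, one_mul, Finset.prod_mul_distrib,
      Finset.prod_const, Finset.card_univ, Fintype.card_fin, smul_eq_mul]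
    -- The Jacobian of the torus parametrization cancels the factors `1 / z_a`.
    have h1 : (∏ a, Complex.exp (θ a * Complex.I)) * ∏ a, (e (θ a))⁻¹ = 1 := by
      rw [← Finset.prod_mul_distrib]
      exact Finset.prod_eq_one fun a _ => mul_inv_cancel₀ (Complex.exp_ne_zero _)
    rw [show ∀ A B C D E : ℂ, A * B * (C * D * E) = B * (D * E) * (A * C) by intros; ring, h1,
      mul_one]
    congr 1
    rw [Finset.sum_mul]
    refine Finset.sum_congr rfl fun σ _ => ?_
    rw [Finset.sum_mul]
    refine Finset.sum_congr rfl fun τ _ => ?_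
    simp only [Matrix.transpose_apply, Matrix.vandermonde_apply, G, Finset.prod_mul_distrib]
    ring
  have hI : ∀ σ τ : Equiv.Perm (Fin n), Integrable
      (fun θ : Fin n → ℝ => ∏ a, G (σ a) (τ a) (θ a)) (Measure.pi fun _ => μ) := fun σ τ =>
    Integrable.fintype_prod fun a => hint _ _
  rw [haarU, torusIntegral]
  simp_rw [hpt]
  rw [hμ, integral_const_mul, integral_finsetSum _ fun σ _ =>
    integrable_finsetSum _ fun τ _ => (hI σ τ).const_mul _]
  simp_rw [integral_finsetSum _ fun τ _ => (hI _ τ).const_mul _, integral_const_mul,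
    integral_fintype_prod_eq_prod]
  have h3 := sum_sign_mul_sign_prod (Matrix.of fun i j : Fin n => circleMean fun z =>
    f z * (z ^ (i : ℕ) * z⁻¹ ^ (j : ℕ)))
  simp only [Matrix.of_apply, circleMean, Finset.prod_mul_distrib, Finset.prod_const,
    Finset.card_univ, Fintype.card_fin] at h3
  have h4 : (n ! : ℂ) ≠ 0 := by exact_mod_cast n.factorial_ne_zero
  have h5 : (2 * Real.pi : ℂ) ≠ 0 := by
    simp [Real.pi_ne_zero]
  rw [mul_pow _ Complex.I, mul_inv, mul_inv, mul_assoc, mul_assoc, inv_mul_cancel_left₀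
    (pow_ne_zero _ Complex.I_ne_zero), inv_mul_eq_iff_eq_mul₀ h4]
  refine Eq.trans ?_ h3
  rw [Finset.mul_sum]
  refine Finset.sum_congr rfl fun σ _ => ?_
  rw [Finset.mul_sum]
  refine Finset.sum_congr rfl fun τ _ => ?_
  rw [inv_pow]
  simp only [G, e, μ]
  ring

end SQCD

namespace SQCD

open Filter Topology

/-! ### The Cauchy–Binet formula for infinite sums -/

/-- A finite product of absolutely convergent series is an absolutely convergent multiple series. -/
theorem summable_norm_prod_and_tsum_prod {N : ℕ} (f : Fin N → ℕ → ℂ)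
    (hf : ∀ i, Summable fun p => ‖f i p‖) :
    (Summable fun m : Fin N → ℕ => ‖∏ i, f i (m i)‖) ∧
      ∑' m : Fin N → ℕ, ∏ i, f i (m i) = ∏ i, ∑' p, f i p := by
  induction N with
  | zero => exact ⟨Summable.of_finite, by simp⟩
  | succ N ih =>
    obtain ⟨h1, h2⟩ := ih (fun i => f i.succ) fun i => hf _
    have h3 : ∀ x : ℕ × (Fin N → ℕ), ∏ i, f i ((Fin.consEquiv fun _ => ℕ) x i)
        = f 0 x.1 * ∏ i : Fin N, f i.succ (x.2 i) := by
      intro x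
      rw [Fin.prod_univ_succ]
      simp [Fin.consEquiv]
    constructor
    · rw [← (Fin.consEquiv fun _ => ℕ).summable_iff]
      refine ((hf 0).mul_norm h1).congr fun x => ?_
      rw [Function.comp_apply, h3]
    · rw [← (Fin.consEquiv fun _ => ℕ).tsum_eq, Fin.prod_univ_succ, ← h2,
        tsum_mul_tsum_of_summable_norm (hf 0) h1]
      exact tsum_congr h3

/-- The strictly decreasing tuple `λ_i + c + r - i` attached to a Dynkin label and an integer. -/
def exponents {r : ℕ} (x : (Fin r → ℕ) × ℕ) (i : Fin (r + 1)) : ℕ :=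
  partitionOfLabel x.1 i + x.2 + (Fin.rev i : ℕ)

theorem partitionOfLabel_last {r : ℕ} (a : Fin r → ℕ) : partitionOfLabel a (Fin.last r) = 0 :=
  Finset.sum_eq_zero fun j _ => if_neg (by simp)

theorem partitionOfLabel_castSucc {r : ℕ} (a : Fin r → ℕ) (j : Fin r) :
    partitionOfLabel a j.castSucc = a j + partitionOfLabel a j.succ := by
  have h : a j = ∑ k, if k = j then a k else 0 := by simp
  rw [partitionOfLabel, partitionOfLabel, h, ← Finset.sum_add_distrib]
  refine Finset.sum_congr rfl fun k _ => ?_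
  simp only [Fin.val_castSucc, Fin.val_succ, Fin.ext_iff]
  split_ifs <;> lia

theorem exponents_last {r : ℕ} (x : (Fin r → ℕ) × ℕ) : exponents x (Fin.last r) = x.2 := by
  simp [exponents, partitionOfLabel_last]

theorem exponents_castSucc {r : ℕ} (x : (Fin r → ℕ) × ℕ) (j : Fin r) :
    exponents x j.castSucc = x.1 j + exponents x j.succ + 1 := by
  simp only [exponents, partitionOfLabel_castSucc, Fin.val_rev, Fin.val_castSucc, Fin.val_succ]
  lia

theorem strictAnti_exponents {r : ℕ} (x : (Fin r → ℕ) × ℕ) : StrictAnti (exponents x) :=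
  Fin.strictAnti_iff_succ_lt.2 fun j => by rw [exponents_castSucc]; lia

theorem exponents_injective {r : ℕ} : Function.Injective (exponents (r := r)) := by
  intro x y h
  refine Prod.ext (funext fun j => ?_) ?_
  · have h1 := congrFun h j.castSucc
    have h2 := congrFun h j.succ
    rw [exponents_castSucc, exponents_castSucc] at h1
    lia
  · rw [← exponents_last x, ← exponents_last y, h]

/-- The last entry is the number of full columns; consecutive gaps minus one are the Dynkin labels.
-/
theorem exists_exponents_eq {r : ℕ} {m : Fin (r + 1) → ℕ} (hm : StrictAnti m) :
    ∃ x, exponents x = m := by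
  refine ⟨(fun j => m j.castSucc - m j.succ - 1, m (Fin.last r)), funext fun i => ?_⟩
  induction i using Fin.reverseInduction with
  | last => exact exponents_last _
  | cast j ih =>
    rw [exponents_castSucc, ih]
    have := hm j.castSucc_lt_succ
    dsimp only
    lia

/-- A strictly decreasing tuple is determined by its range, which a permutation does not change. -/
theorem exponents_comp_perm_injective {r : ℕ} :
    Function.Injective fun x : ((Fin r → ℕ) × ℕ) × Equiv.Perm (Fin (r + 1)) =>
      exponents x.1 ∘ x.2 := by
  rintro ⟨x, σ⟩ ⟨y, τ⟩ h
  dsimp only at h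
  have hr := congrArg Set.range h
  rw [σ.surjective.range_comp, τ.surjective.range_comp] at hr
  have hxy : exponents x = exponents y :=
    Set.range_injOn_strictAnti (strictAnti_exponents x) (strictAnti_exponents y) hr
  rw [hxy] at h
  refine Prod.ext (exponents_injective hxy) (Equiv.ext fun i => ?_)
  exact (strictAnti_exponents y).injective (congrFun h i)

theorem exists_exponents_comp_perm {r : ℕ} {m : Fin (r + 1) → ℕ} (hm : Function.Injective m) :
    ∃ x : ((Fin r → ℕ) × ℕ) × Equiv.Perm (Fin (r + 1)), exponents x.1 ∘ x.2 = m := by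
  have h1 : StrictMono (m ∘ Tuple.sort m) :=
    (Tuple.monotone_sort m).strictMono_of_injective (hm.comp (Tuple.sort m).injective)
  obtain ⟨x, hx⟩ := exists_exponents_eq (h1.comp_strictAnti Fin.rev_strictAnti)
  refine ⟨(x, (Fin.revPerm.trans (Tuple.sort m)).symm), ?_⟩
  dsimp only
  rw [hx]
  ext i
  simp

/-- Expanding one determinant gives a sum over all tuples `m`. Tuples with a repeated entry drop
out, and the others are grouped by their decreasing rearrangement; the sum over permutations
restores the other determinant. -/
theorem hasSum_cauchyBinet {r : ℕ} {a b : Fin (r + 1) → ℕ → ℂ}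
    (ha : ∀ i, Summable fun p => ‖a i p‖) (hb : ∀ i, Summable fun p => ‖b i p‖) :
    HasSum (fun x : (Fin r → ℕ) × ℕ =>
        (Matrix.of fun l i => a l (exponents x i)).det
          * (Matrix.of fun l i => b l (exponents x i)).det)
      (Matrix.of fun i j => ∑' p, a i p * b j p).det := by
  let Φ : (Fin (r + 1) → ℕ) → ℂ := fun m =>
    (∏ i, a i (m i)) * (Matrix.of fun l i => b l (m i)).det
  have hΦ : HasSum Φ (Matrix.of fun i j => ∑' p, a i p * b j p).det := by
    rw [← Matrix.det_transpose, Matrix.det_apply']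
    have hΦ' : Φ = fun m => ∑ σ : Equiv.Perm (Fin (r + 1)), ((Equiv.Perm.sign σ : ℤ) : ℂ)
        * ∏ i, (a i (m i) * b (σ i) (m i)) := by
      ext m
      simp only [Φ]
      rw [Matrix.det_apply', Finset.mul_sum]
      refine Finset.sum_congr rfl fun σ _ => ?_
      rw [Finset.prod_mul_distrib]
      simp only [Matrix.of_apply]
      ring
    rw [hΦ']
    refine hasSum_sum fun σ _ => HasSum.mul_left _ ?_
    obtain ⟨h1, h2⟩ := summable_norm_prod_and_tsum_prod (fun i p => a i p * b (σ i) p) fun i =>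
      summable_norm_mul_of_summable_norm (ha i) (hb (σ i))
    simp only [Matrix.transpose_apply, Matrix.of_apply]
    rw [← h2]
    exact h1.of_norm.hasSum
  have h0 : ∀ m ∉ Set.range fun x : ((Fin r → ℕ) × ℕ) × Equiv.Perm (Fin (r + 1)) =>
      exponents x.1 ∘ x.2, Φ m = 0 := by
    intro m hm
    have hni : ¬ Function.Injective m := fun h => hm (exists_exponents_comp_perm h)
    rw [Function.not_injective_iff] at hni
    obtain ⟨i, j, hij, hne⟩ := hni
    have : (Matrix.of fun l i => b l (m i)).det = 0 :=
      Matrix.det_zero_of_column_eq hne fun l => by simp [hij]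
    simp only [Φ, this, mul_zero]
  rw [← exponents_comp_perm_injective.hasSum_iff h0] at hΦ
  have h := hΦ.prod_fiberwise fun x => hasSum_fintype _
  refine h.congr_fun fun x => ?_
  simp only [Function.comp_apply, Φ]
  rw [← Matrix.det_transpose, Matrix.det_apply', Finset.sum_mul]
  refine Finset.sum_congr rfl fun σ _ => ?_
  have := Matrix.det_permute' σ (Matrix.of fun l i => b l (exponents x i))
  simp only [Matrix.transpose_apply, Matrix.of_apply]
  rw [mul_right_comm, ← this, mul_comm]
  rfl

/-! ### The Jacobi–Trudi formula -/

section JacobiTrudi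

variable {R : Type*} [CommRing R] {r : ℕ}

/-- The Jacobi–Trudi determinant `det h_{m_i - r + l} (u)`. -/
noncomputable def jacobiTrudi (u : Fin (r + 1) → R) (m : Fin (r + 1) → ℕ) : R :=
  (Matrix.of fun l i : Fin (r + 1) => complete u (Fin.rev l : ℕ) (m i)).det

theorem map_jacobiTrudi {S : Type*} [CommRing S] (f : R →+* S) (u : Fin (r + 1) → R)
    (m : Fin (r + 1) → ℕ) : f (jacobiTrudi u m) = jacobiTrudi (fun k => f (u k)) m := by
  rw [jacobiTrudi, RingHom.map_det, jacobiTrudi]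
  congr 1
  ext l i
  exact map_complete f u _ _

theorem jacobiTrudi_rev (u : Fin (r + 1) → R) :
    jacobiTrudi u (fun i => (Fin.rev i : ℕ)) = 1 := by
  rw [← det_complete_lower_eq_one (r + 1) u, ← Matrix.det_submatrix_equiv_self Fin.revPerm]
  rfl

/-- The matrix of powers is a coefficient matrix independent of `m` times the Jacobi–Trudi matrix.
The staircase exponents, where the latter has determinant `1`, identify the first factor. -/
theorem det_pow_eq_mul_jacobiTrudi (u : Fin (r + 1) → R) (m : Fin (r + 1) → ℕ) :
    (Matrix.of fun k i : Fin (r + 1) => u k ^ m i).det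
      = (Matrix.of fun k i : Fin (r + 1) => u k ^ (Fin.rev i : ℕ)).det * jacobiTrudi u m := by
  have h : ∀ m : Fin (r + 1) → ℕ, (Matrix.of fun k i : Fin (r + 1) => u k ^ m i).det
      = (Matrix.of fun k l : Fin (r + 1) =>
          (elemPoly (Finset.univ.erase k) u).coeff (Fin.rev l : ℕ)).det * jacobiTrudi u m := by
    intro m
    rw [jacobiTrudi, ← Matrix.det_mul]
    congr 1
    ext k i
    rw [Matrix.mul_apply, Matrix.of_apply, ← sum_elemPoly_coeff_mul_complete u k (m i),
      ← Equiv.sum_comp Fin.revPerm]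
    rfl
  rw [h m, h fun i => (Fin.rev i : ℕ), jacobiTrudi_rev, mul_one]

theorem det_pow_rev_ne_zero [IsDomain R] {u : Fin (r + 1) → R} (hu : Function.Injective u) :
    (Matrix.of fun k i : Fin (r + 1) => u k ^ (Fin.rev i : ℕ)).det ≠ 0 := by
  have h := Matrix.det_permute' Fin.revPerm (Matrix.vandermonde u)
  have h2 : (Matrix.of fun k i : Fin (r + 1) => u k ^ (Fin.rev i : ℕ))
      = (Matrix.vandermonde u).submatrix id Fin.revPerm := rfl
  rw [h2, h]
  refine mul_ne_zero ?_ (Matrix.det_vandermonde_ne_zero_iff.2 hu)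
  rcases Int.units_eq_one_or (Equiv.Perm.sign (Fin.revPerm (n := r + 1))) with h | h <;> simp [h]

theorem complete_mul (t : R) {ι : Type*} [Fintype ι] (u : ι → R) (j p : ℕ) :
    complete (fun k => t * u k) j p = t ^ (p - j) * complete u j p := by
  rw [complete_eq_ite, complete_eq_ite, coeff_completeSeries_mul, mul_ite, mul_zero]

theorem jacobiTrudi_mul (t : R) (u : Fin (r + 1) → R) (lam : Fin (r + 1) → ℕ) :
    jacobiTrudi (fun k => t * u k) (fun i => lam i + (Fin.rev i : ℕ))
      = t ^ (∑ i, lam i) * jacobiTrudi u fun i => lam i + (Fin.rev i : ℕ) := by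
  rw [jacobiTrudi, jacobiTrudi, Matrix.det_apply', Matrix.det_apply', Finset.mul_sum]
  refine Finset.sum_congr rfl fun σ _ => ?_
  rw [mul_left_comm]
  congr 1
  simp only [Matrix.of_apply]
  -- In this case the truncated subtractions are exact and add up to `∑ i, lam i`; otherwise a
  -- factor of negative degree kills both products.
  by_cases h : ∀ i, (Fin.rev (σ i) : ℕ) ≤ lam i + (Fin.rev i : ℕ)
  · simp_rw [complete_mul]
    rw [Finset.prod_mul_distrib, Finset.prod_pow_eq_pow_sum, Finset.sum_tsub_distrib _ fun i _ => h i,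
      Finset.sum_add_distrib, Equiv.sum_comp σ fun i => (Fin.rev i : ℕ), Nat.add_sub_cancel]
  · push Not at h
    obtain ⟨i, hi⟩ := h
    rw [Finset.prod_eq_zero (Finset.mem_univ i) (complete_of_lt _ hi),
      Finset.prod_eq_zero (Finset.mem_univ i) (complete_of_lt _ hi), mul_zero]

/-- Adding `c` columns of full length multiplies a Schur polynomial by `(∏ u_k) ^ c`. -/
theorem jacobiTrudi_add (u : Fin (r + 1) → R) (m : Fin (r + 1) → ℕ) (c : ℕ) :
    jacobiTrudi u (fun i => m i + c) = (∏ k, u k) ^ c * jacobiTrudi u m := by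
  -- With indeterminates over `ℤ` the Vandermonde factor can be cancelled; specialization then
  -- reaches any ring.
  have h : jacobiTrudi (MvPolynomial.X : Fin (r + 1) → MvPolynomial (Fin (r + 1)) ℤ)
      (fun i => m i + c) = (∏ k, MvPolynomial.X k) ^ c * jacobiTrudi MvPolynomial.X m := by
    refine mul_left_cancel₀ (det_pow_rev_ne_zero (MvPolynomial.X_injective)) ?_
    rw [← det_pow_eq_mul_jacobiTrudi, mul_left_comm, ← det_pow_eq_mul_jacobiTrudi,
      ← Finset.prod_pow, ← Matrix.det_mul_column]
    congr 1
    ext1 k i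
    simp [pow_add, mul_comm]
  have h2 := congrArg (MvPolynomial.eval₂Hom (Int.castRingHom R) u) h
  rw [map_mul, map_pow, map_prod, map_jacobiTrudi, map_jacobiTrudi] at h2
  simpa using h2

end JacobiTrudi

/-- The Weyl denominator is cancelled between polynomials, before evaluation, so coinciding
eigenvalues are allowed. -/
theorem irrepChar_eq_jacobiTrudi {r : ℕ} (a : Fin r → ℕ) (x : Fin r → ℂ) :
    irrepChar a x = jacobiTrudi (eigenvalue x) (exponents (a, 0)) := by
  have h0 : alternant (0 : Fin (r + 1) → ℕ) = (Matrix.of fun k i : Fin (r + 1) =>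
      (MvPolynomial.X k : MvPolynomial (Fin (r + 1)) ℂ) ^ (Fin.rev i : ℕ)).det := by
    simp [alternant]
  have h := alternant_eq_mul_irrepPoly a
  have h1 : alternant (partitionOfLabel a) = (Matrix.of fun k i : Fin (r + 1) =>
      (MvPolynomial.X k : MvPolynomial (Fin (r + 1)) ℂ) ^ exponents (a, 0) i).det := rfl
  rw [h1, det_pow_eq_mul_jacobiTrudi, h0] at h
  rw [irrepChar, ← mul_left_cancel₀ (det_pow_rev_ne_zero MvPolynomial.X_injective) h,
    map_jacobiTrudi]
  simp

theorem continuous_jacobiTrudi {r : ℕ} (m : Fin (r + 1) → ℕ) :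
    Continuous fun u : Fin (r + 1) → ℂ => jacobiTrudi u m :=
  Continuous.matrix_det (continuous_matrix fun _ _ => continuous_complete _ _)

theorem sum_partitionOfLabel {r : ℕ} (a : Fin r → ℕ) :
    ∑ i, partitionOfLabel a i = ∑ j : Fin r, ((j : ℕ) + 1) * a j := by
  simp only [partitionOfLabel]
  rw [Finset.sum_comm]
  refine Finset.sum_congr rfl fun j _ => ?_
  rw [← Finset.sum_filter, Finset.sum_const, smul_eq_mul]
  congr 1
  have h : (Finset.univ.filter fun i : Fin (r + 1) => (i : ℕ) ≤ j) = Finset.Iic j.castSucc := by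
    ext i
    simp [Fin.le_def]
  rw [h, Fin.card_Iic, Fin.val_castSucc]

/-- The dual partition is the complement in a rectangle of width `∑ j, a j`, rotated. -/
theorem partitionOfLabel_rev_add {r : ℕ} (a : Fin r → ℕ) (i : Fin (r + 1)) :
    partitionOfLabel (fun j => a (Fin.rev j)) (Fin.rev i) + partitionOfLabel a i = ∑ j, a j := by
  rw [partitionOfLabel, ← Equiv.sum_comp Fin.revPerm, partitionOfLabel, ← Finset.sum_add_distrib]
  refine Finset.sum_congr rfl fun j _ => ?_
  simp only [Fin.revPerm_apply, Fin.rev_rev, Fin.val_rev]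
  split_ifs <;> lia

/-- The character of the dual representation, at distinct eigenvalues. -/
theorem jacobiTrudi_dual_of_injective {r : ℕ} (a : Fin r → ℕ) {w : Fin (r + 1) → ℂ}
    (hw : ∀ k, w k ≠ 0) (hinj : Function.Injective w) :
    jacobiTrudi w (exponents (fun j => a (Fin.rev j), 0))
      = (∏ k, w k) ^ (∑ j, a j) * jacobiTrudi (fun k => (w k)⁻¹) (exponents (a, 0)) := by
  -- Reversing the columns pairs exponents whose sum is `∑ j, b j + r`. The case `b = 0` then
  -- relates the Weyl denominators at `w` and at its inverse, and dividing by it removes the sign.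
  have key : ∀ b : Fin r → ℕ,
      (∏ k, w k) ^ (∑ j, b j + r)
          * (Matrix.of fun k i : Fin (r + 1) => (w k)⁻¹ ^ exponents (b, 0) i).det
        = ((Equiv.Perm.sign (Fin.revPerm (n := r + 1)) : ℤ) : ℂ)
          * (Matrix.of fun k i : Fin (r + 1) =>
            w k ^ exponents (fun j => b (Fin.rev j), 0) i).det := by
    intro b
    rw [← Matrix.det_permute', ← Finset.prod_pow, ← Matrix.det_mul_column]
    congr 1
    ext k i
    simp only [Matrix.of_apply, Matrix.submatrix_apply, id, Fin.revPerm_apply, inv_pow]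
    rw [mul_inv_eq_iff_eq_mul₀ (pow_ne_zero _ (hw k)), ← pow_add]
    congr 1
    have := partitionOfLabel_rev_add b i
    simp only [exponents, Fin.val_rev]
    lia
  have h0 := key 0
  have e0 : exponents ((0 : Fin r → ℕ), 0) = fun i => (Fin.rev i : ℕ) := by
    ext i; simp [exponents, partitionOfLabel]
  have e1 : exponents ((fun j => (0 : Fin r → ℕ) (Fin.rev j)), 0) = fun i => (Fin.rev i : ℕ) := e0
  rw [e0, e1] at h0
  simp only [Pi.zero_apply, Finset.sum_const_zero, zero_add] at h0
  have h1 := key a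
  rw [det_pow_eq_mul_jacobiTrudi, det_pow_eq_mul_jacobiTrudi w, pow_add, ← mul_assoc,
    mul_assoc (_ ^ _) (_ ^ _), h0, ← mul_assoc] at h1
  have hs : ((Equiv.Perm.sign (Fin.revPerm (n := r + 1)) : ℤ) : ℂ) ≠ 0 := by
    rcases Int.units_eq_one_or (Equiv.Perm.sign (Fin.revPerm (n := r + 1))) with h | h <;> simp [h]
  refine mul_left_cancel₀ (mul_ne_zero hs (det_pow_rev_ne_zero hinj)) ?_
  linear_combination -h1

theorem jacobiTrudi_dual {r : ℕ} (a : Fin r → ℕ) {w : Fin (r + 1) → ℂ} (hw : ∀ k, w k ≠ 0) :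
    jacobiTrudi w (exponents (fun j => a (Fin.rev j), 0))
      = (∏ k, w k) ^ (∑ j, a j) * jacobiTrudi (fun k => (w k)⁻¹) (exponents (a, 0)) := by
  have hinv : ContinuousAt (fun u : Fin (r + 1) → ℂ => fun k => (u k)⁻¹) w :=
    continuousAt_pi.2 fun k => (continuous_apply k).continuousAt.inv₀ (hw k)
  refine eq_of_continuousAt_of_injective
    (F := fun w => jacobiTrudi w (exponents (fun j => a (Fin.rev j), 0)))
    (G := fun w => (∏ k, w k) ^ (∑ j, a j) * jacobiTrudi (fun k => (w k)⁻¹) (exponents (a, 0)))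
    (continuous_jacobiTrudi _).continuousAt ?_ ?_
  · refine ContinuousAt.mul (by fun_prop) ?_
    exact (continuous_jacobiTrudi (exponents (a, 0))).continuousAt.comp hinv
  · have : ∀ᶠ u in 𝓝 w, ∀ k, u k ≠ 0 :=
      eventually_all.2 fun k => (continuous_apply k).continuousAt.eventually_ne (hw k)
    filter_upwards [this] with u hu hi
    exact jacobiTrudi_dual_of_injective a hu hi

end SQCD

namespace SQCD

open PowerSeries

/-! ### The quantities of the theorem -/

section

variable {r : ℕ} {t s : ℂ} {x y : Fin r → ℂ}

theorem phiPlus_eq (hs : ∀ k, ‖s * (eigenvalue y k)⁻¹‖ < 1) {z : ℂ} (hz : ‖z‖ = 1) :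
    phiPlus s y z = ∏ k, (1 - s * (eigenvalue y k)⁻¹ * z)⁻¹ := by
  refine (peConverges_and_PE_eq_prod (w := fun k => s * (eigenvalue y k)⁻¹ * z) (fun k => ?_)
    fun m => ?_).2
  · rw [norm_mul, hz, mul_one]
    exact hs k
  · simp only [Prod.pow_mk, antifundChar, eigenvalue_pow, Finset.mul_sum, Finset.sum_mul, mul_pow,
      inv_pow]

theorem phiMinus_eq (ht : ∀ k, ‖t * eigenvalue x k‖ < 1) {z : ℂ} (hz : ‖z‖ = 1) :
    phiMinus t x z = ∏ k, (1 - t * eigenvalue x k * z⁻¹)⁻¹ := by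
  refine (peConverges_and_PE_eq_prod (w := fun k => t * eigenvalue x k * z⁻¹) (fun k => ?_)
    fun m => ?_).2
  · rw [norm_mul, norm_inv, hz, inv_one, mul_one]
    exact ht k
  · simp only [Prod.pow_mk, fundChar, eigenvalue_pow, Finset.mul_sum, Finset.sum_mul, mul_pow,
      inv_pow]

theorem PE_quarkChar {n : ℕ} (ht : ∀ k, ‖t * eigenvalue x k‖ < 1)
    (hs : ∀ k, ‖s * (eigenvalue y k)⁻¹‖ < 1) {z : Fin n → ℂ} (hz : ∀ a, ‖z a‖ = 1) :
    PEConverges quarkChar (t, s, x, y, z) ∧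
      PE quarkChar (t, s, x, y, z) = ∏ a, ((∏ k, (1 - t * eigenvalue x k * (z a)⁻¹)⁻¹)
        * ∏ k, (1 - s * (eigenvalue y k)⁻¹ * z a)⁻¹) := by
  have h := peConverges_and_PE_eq_prod (f := quarkChar) (v := (t, s, x, y, z))
    (w := Sum.elim (fun p : Fin n × Fin (r + 1) => t * eigenvalue x p.2 * (z p.1)⁻¹)
      fun p : Fin n × Fin (r + 1) => s * (eigenvalue y p.2)⁻¹ * z p.1) (fun j => ?_) fun m => ?_
  · refine ⟨h.1, h.2.trans ?_⟩
    rw [Fintype.prod_sum_type, Fintype.prod_prod_type, Fintype.prod_prod_type,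
      ← Finset.prod_mul_distrib]
    rfl
  · rcases j with j | j
    · rw [Sum.elim_inl, norm_mul, norm_inv, hz, inv_one, mul_one]
      exact ht _
    · rw [Sum.elim_inr, norm_mul, hz, mul_one]
      exact hs _
  · simp only [Prod.pow_mk, quarkChar, fundChar, antifundChar, eigenvalue_pow,
      Fintype.sum_sum_type, Fintype.sum_prod_type, Sum.elim_inl, Sum.elim_inr, Pi.pow_apply,
      Finset.mul_sum, Finset.sum_mul, mul_pow, inv_pow]

theorem PE_mesonChar (ht : ∀ k, ‖t * eigenvalue x k‖ < 1)
    (hs : ∀ k, ‖s * (eigenvalue y k)⁻¹‖ < 1) :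
    PEConverges mesonChar (t, s, x, y) ∧ PE mesonChar (t, s, x, y)
      = ∏ k, ∏ l, (1 - t * eigenvalue x k * (s * (eigenvalue y l)⁻¹))⁻¹ := by
  have h := peConverges_and_PE_eq_prod (f := mesonChar) (v := (t, s, x, y))
    (w := fun p : Fin (r + 1) × Fin (r + 1) =>
      t * eigenvalue x p.1 * (s * (eigenvalue y p.2)⁻¹))
    (fun j => norm_mul_lt_one (ht _) (hs _)) fun m => ?_
  · exact ⟨h.1, h.2.trans (Fintype.prod_prod_type _)⟩
  · simp only [Prod.pow_mk, mesonChar, fundChar, antifundChar, eigenvalue_pow,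
      Fintype.sum_prod_type, Finset.mul_sum, Finset.sum_mul, mul_pow, inv_pow]
    rw [Finset.sum_comm]
    refine Finset.sum_congr rfl fun k _ => Finset.sum_congr rfl fun l _ => ?_
    ring

/-- Written as an infinite series so that `circleMean_tsum_mul_tsum` applies to a polynomial factor.
-/
theorem prod_one_sub_mul_eq_tsum {N : ℕ} (v : Fin N → ℂ) (z : ℂ) :
    ∏ k, (1 - v k * z) = ∑' q, (elemPoly Finset.univ v).coeff q * z ^ q := by
  rw [tsum_eq_sum (s := Finset.range ((elemPoly Finset.univ v).natDegree + 1)),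
    ← Polynomial.eval_eq_sum_range, elemPoly, Polynomial.eval_prod]
  · simp
  · intro q hq
    rw [Polynomial.coeff_eq_zero_of_natDegree_lt, zero_mul]
    simpa using hq

theorem norm_inv_eq_one {z : ℂ} (hz : ‖z‖ = 1) : ‖z⁻¹‖ = 1 := by rw [norm_inv, hz, inv_one]

/-- The Fourier coefficients of `φ₋ / φ₊` vanish beyond the number of flavours. -/
theorem coeffU_eq_zero (ht : ∀ k, ‖t * eigenvalue x k‖ < 1)
    (hs : ∀ k, ‖s * (eigenvalue y k)⁻¹‖ < 1) {m : ℕ} (hm : r + 1 < m) :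
    coeffU t s x y m = 0 := by
  set e := elemPoly Finset.univ fun k => s * (eigenvalue y k)⁻¹ with he
  have he0 : ∀ q, r + 1 < q → e.coeff q = 0 := by
    intro q hq
    refine Polynomial.coeff_eq_zero_of_natDegree_lt ?_
    refine (natDegree_elemPoly_le _ _).trans_lt ?_
    rwa [Finset.card_univ, Fintype.card_fin]
  have hes : Summable fun q => ‖e.coeff q‖ :=
    summable_of_ne_finset_zero (s := Finset.range (r + 2)) fun q hq => by
      rw [he0 q (by rw [Finset.mem_range] at hq; lia), norm_zero]
  rw [coeffU, fourierCoeffCircle_eq_circleMean, circleMean_congr (g := fun z =>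
    (∑' p, complete (fun k => t * eigenvalue x k) m p * z⁻¹ ^ p) * ∑' q, e.coeff q * z ^ q),
    circleMean_tsum_mul_tsum (summable_norm_complete ht m) hes]
  · refine (tsum_congr fun p => ?_).trans tsum_zero
    rcases lt_or_ge p m with h | h
    · rw [complete_of_lt _ h, zero_mul]
    · rw [he0 p (by lia), mul_zero]
  · intro z hz
    rw [phiMinus_eq ht hz, phiPlus_eq hs hz, tsum_complete_mul_pow ht m (norm_inv_eq_one hz).le,
      he, ← prod_one_sub_mul_eq_tsum, zpow_neg, zpow_natCast, Finset.prod_inv_distrib (fun k =>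
        1 - s * (eigenvalue y k)⁻¹ * z), div_inv_eq_mul, inv_pow]
    ring

theorem hilbertSeries_eq_det_gram (n : ℕ) (ht : ∀ k, ‖t * eigenvalue x k‖ < 1)
    (hs : ∀ k, ‖s * (eigenvalue y k)⁻¹‖ < 1) :
    hilbertSeries n t s x y
      = (gram n (fun k => t * eigenvalue x k) fun k => s * (eigenvalue y k)⁻¹).det := by
  let f : ℂ → ℂ := fun z => (∏ k, (1 - t * eigenvalue x k * z⁻¹)⁻¹)
    * ∏ k, (1 - s * (eigenvalue y k)⁻¹ * z)⁻¹
  have hf : Continuous fun θ : ℝ => f (Complex.exp (θ * Complex.I)) := by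
    have hn : ∀ θ : ℝ, ‖Complex.exp (θ * Complex.I)‖ = 1 := Complex.norm_exp_ofReal_mul_I
    have h1 : Continuous fun θ : ℝ => Complex.exp (θ * Complex.I) := by fun_prop
    have h2 : Continuous fun θ : ℝ => (Complex.exp (θ * Complex.I))⁻¹ :=
      h1.inv₀ fun θ => Complex.exp_ne_zero _
    refine (continuous_finsetProd _ fun k _ => Continuous.inv₀ (by fun_prop) fun θ => ?_).mul
      (continuous_finsetProd _ fun k _ => Continuous.inv₀ (by fun_prop) fun θ => ?_)
    · refine one_sub_ne_zero_of_norm_lt_one ?_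
      rw [norm_mul, norm_inv, hn, inv_one, mul_one]
      exact ht k
    · refine one_sub_ne_zero_of_norm_lt_one ?_
      rw [norm_mul, hn, mul_one]
      exact hs k
  have h1 : hilbertSeries n t s x y = haarU n fun z => ∏ a, f (z a) := by
    rw [hilbertSeries, haarU, haarU, torusIntegral, torusIntegral]
    congr 2
    ext θ
    rw [(PE_quarkChar ht hs fun a => ?_).2]
    simp [torusMap, Complex.norm_exp_ofReal_mul_I]
  rw [h1, haarU_prod_eq_det n hf, ← Matrix.det_transpose]
  congr 1
  ext i j
  rw [Matrix.transpose_apply, Matrix.of_apply, gram, Matrix.of_apply,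
    ← circleMean_tsum_mul_tsum (summable_norm_complete ht i) (summable_norm_complete hs j)]
  refine circleMean_congr fun z hz => ?_
  rw [tsum_complete_mul_pow ht i (norm_inv_eq_one hz).le, tsum_complete_mul_pow hs j hz.le]
  simp only [f]
  ring

theorem hilbertSeries_eq_prod {n : ℕ} (hn : r + 1 ≤ n) (ht : ∀ k, ‖t * eigenvalue x k‖ < 1)
    (hs : ∀ k, ‖s * (eigenvalue y k)⁻¹‖ < 1) :
    hilbertSeries n t s x y
      = ∏ k, ∏ l, (1 - t * eigenvalue x k * (s * (eigenvalue y l)⁻¹))⁻¹ := by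
  rw [hilbertSeries_eq_det_gram n ht hs, det_gram_of_le hn ht hs]

theorem jacobiTrudi_mul_exponents (t : ℂ) {u : Fin (r + 1) → ℂ} (hu : ∏ k, u k = 1)
    (a : Fin r → ℕ) (c : ℕ) :
    jacobiTrudi (fun k => t * u k) (exponents (a, c))
      = t ^ ((r + 1) * c + ∑ j : Fin r, ((j : ℕ) + 1) * a j)
        * jacobiTrudi u (exponents (a, 0)) := by
  have h : exponents (a, c) = fun i => exponents (a, 0) i + c := by
    ext i; simp only [exponents]; lia
  have h0 : exponents (a, 0) = fun i => partitionOfLabel a i + (Fin.rev i : ℕ) := rfl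
  rw [h, jacobiTrudi_add, Finset.prod_mul_distrib, hu, Finset.prod_const, Finset.card_univ,
    Fintype.card_fin, mul_one, h0, jacobiTrudi_mul, sum_partitionOfLabel, ← pow_mul, ← mul_assoc,
    ← pow_add]

/-- The Cauchy identity, in terms of irreducible characters. -/
theorem hasSum_biChar (hx : ∀ k, x k ≠ 0) (hy : ∀ k, y k ≠ 0)
    (ht : ∀ k, ‖t * eigenvalue x k‖ < 1) (hs : ∀ k, ‖s * (eigenvalue y k)⁻¹‖ < 1) :
    HasSum (fun a : (Fin r → ℕ) × ℕ => biChar a.1 (fun j => a.1 (Fin.rev j)) x y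
        * (t * s) ^ (∑ j : Fin r, ((j : ℕ) + 1) * a.1 j) * ((t * s) ^ (r + 1)) ^ a.2)
      (∏ k, ∏ l, (1 - t * eigenvalue x k * (s * (eigenvalue y l)⁻¹))⁻¹) := by
  have h := hasSum_cauchyBinet
    (a := fun l : Fin (r + 1) => complete (fun k => t * eigenvalue x k) (Fin.rev l : ℕ))
    (b := fun l : Fin (r + 1) => complete (fun k => s * (eigenvalue y k)⁻¹) (Fin.rev l : ℕ))
    (fun l => summable_norm_complete ht _) fun l => summable_norm_complete hs _
  -- Jacobi–Trudi rows are numbered in reverse; reversing rows and columns together leaves the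
  -- determinant unchanged.
  rw [← det_gram ht hs, ← Matrix.det_submatrix_equiv_self Fin.revPerm]
  refine h.congr_fun fun a => ?_
  have hpx := prod_eigenvalue hx
  have hpy : ∏ k, (eigenvalue y k)⁻¹ = 1 := by
    rw [Finset.prod_inv_distrib, prod_eigenvalue hy, inv_one]
  change _ = jacobiTrudi _ (exponents (a.1, a.2)) * jacobiTrudi _ (exponents (a.1, a.2))
  rw [jacobiTrudi_mul_exponents t hpx, jacobiTrudi_mul_exponents s hpy, biChar,
    irrepChar_eq_jacobiTrudi, irrepChar_eq_jacobiTrudi, jacobiTrudi_dual _ (eigenvalue_ne_zero hy),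
    prod_eigenvalue hy, one_pow, one_mul]
  ring

/-- The product of the numbers `‖c * u k‖` is `‖c‖ ^ (n + 1)`. This supplies `‖t‖ < 1` and `‖s‖ <
1`, needed for the geometric series and at `x = y = 1`. -/
theorem norm_lt_one_of_prod_eq_one {n : ℕ} {c : ℂ} {u : Fin (n + 1) → ℂ} (hu : ∏ k, u k = 1)
    (h : ∀ k, ‖c * u k‖ < 1) : ‖c‖ < 1 := by
  by_contra hc
  push Not at hc
  have h1 : ∏ k, ‖c * u k‖ < 1 := by
    rw [Fin.prod_univ_succ]
    refine mul_lt_one_of_nonneg_of_lt_one_left (norm_nonneg _) (h 0) ?_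
    exact Finset.prod_le_one (fun _ _ => norm_nonneg _) fun k _ => (h _).le
  rw [← norm_prod, Finset.prod_mul_distrib, hu, mul_one, Finset.prod_const, norm_pow] at h1
  exact absurd (one_le_pow₀ hc) (not_le.2 h1)

end

end SQCD

/-! ### Assembly of the theorem. -/

theorem mainTheorem2 (r Nc : ℕ) (hN : r + 1 ≤ Nc) (t s : ℂ) (x y : Fin r → ℂ)
    (hx : ∀ k, x k ≠ 0) (hy : ∀ k, y k ≠ 0)
    (ht : ∀ k, ‖t * SQCD.eigenvalue x k‖ < 1)
    (hs : ∀ k, ‖s * (SQCD.eigenvalue y k)⁻¹‖ < 1) :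
    -- the plethystic exponentials converge
    (∀ z : Fin Nc → ℂ, (∀ a, ‖z a‖ = 1) → SQCD.PEConverges SQCD.quarkChar (t, s, x, y, z)) ∧
    SQCD.PEConverges SQCD.mesonChar (t, s, x, y) ∧
    -- the correction kernel vanishes
    (∀ i j : ℕ, Summable (SQCD.kernelTerm t s x y i j) ∧ SQCD.kernelK Nc t s x y i j = 0) ∧
    -- the refined Hilbert series
    SQCD.hilbertSeries Nc t s x y = SQCD.PE SQCD.mesonChar (t, s, x, y) ∧
    -- its expansion in irreducible characters
    Summable (fun n : Fin r → ℕ =>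
      SQCD.biChar n (fun j => n (Fin.rev j)) x y * (t * s) ^ (∑ j : Fin r, ((j : ℕ) + 1) * n j)) ∧
    SQCD.hilbertSeries Nc t s x y
      = 1 / (1 - (t * s) ^ (r + 1)) * ∑' n : Fin r → ℕ,
        SQCD.biChar n (fun j => n (Fin.rev j)) x y
          * (t * s) ^ (∑ j : Fin r, ((j : ℕ) + 1) * n j) ∧
    -- the unrefined Hilbert series
    SQCD.hilbertSeries Nc t s (1 : Fin r → ℂ) (1 : Fin r → ℂ)
      = 1 / (1 - t * s) ^ ((r + 1) ^ 2) := by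
  have hU : ∀ i j k : ℕ, r + 1 ≤ i + k → SQCD.kernelTerm t s x y i j k = 0 := by
    intro i j k h
    have := SQCD.coeffU_eq_zero ht hs (m := i + (k + 1)) (by lia)
    rw [SQCD.kernelTerm]
    push_cast at this
    rw [this, zero_mul]
  have ht1 : ‖t‖ < 1 := SQCD.norm_lt_one_of_prod_eq_one (SQCD.prod_eigenvalue hx) ht
  have hs1 : ‖s‖ < 1 := SQCD.norm_lt_one_of_prod_eq_one
    (by rw [Finset.prod_inv_distrib, SQCD.prod_eigenvalue hy, inv_one]) hs
  have hsum := SQCD.hasSum_biChar hx hy ht hs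
  have hchar : Summable (fun n : Fin r → ℕ =>
      SQCD.biChar n (fun j => n (Fin.rev j)) x y
        * (t * s) ^ (∑ j : Fin r, ((j : ℕ) + 1) * n j)) := by
    -- The terms without full columns, `c = 0`, form a subfamily of the summable double family.
    have h := hsum.summable.comp_injective
      (i := fun n : Fin r → ℕ => (n, 0)) fun m n h => (Prod.ext_iff.1 h).1
    simpa [Function.comp_def] using h
  have hts : ‖(t * s) ^ (r + 1)‖ < 1 := by
    rw [norm_pow]
    exact pow_lt_one₀ (norm_nonneg _) (SQCD.norm_mul_lt_one ht1 hs1) (by lia)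
  refine ⟨fun z hz => (SQCD.PE_quarkChar ht hs hz).1, (SQCD.PE_mesonChar ht hs).1,
    fun i j => ⟨?_, ?_⟩, ?_, hchar, ?_, ?_⟩
  · exact summable_of_ne_finset_zero (s := Finset.range (r + 1)) fun k hk =>
      hU i j k (by rw [Finset.mem_range] at hk; lia)
  · rw [SQCD.kernelK]
    split_ifs with h
    · exact (tsum_congr fun k => hU i j k (by lia)).trans tsum_zero
    · rfl
  · rw [SQCD.hilbertSeries_eq_prod hN ht hs, (SQCD.PE_mesonChar ht hs).2]
  · rw [SQCD.hilbertSeries_eq_prod hN ht hs, ← hsum.tsum_eq,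
      ← tsum_mul_tsum_of_summable_norm hchar.norm (summable_norm_geometric_of_norm_lt_one hts),
      tsum_geometric_of_norm_lt_one hts, mul_comm, one_div]
  · rw [SQCD.hilbertSeries_eq_prod hN (by simpa using ht1) (by simpa using hs1)]
    simp [← pow_mul, sq]
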